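/- Let $n\ge 2$ and $s\in(0,1)$. For $\tau\ge 1$ put $$H(\tau)=2\pi\alpha_n\int_0^\pi \sin^{n-2}\theta\,\frac{\big(\sqrt{\tau^2-\sin^2\theta}+\cos\theta\big)^{1+2s}}{\sqrt{\tau^2-\sin^2\theta}}\,d\theta,\qquad \alpha_n=\frac{\pi^{(n-3)/2}}{\Gamma\left(\frac{n-1}{2}\right)}.$$ (1) Let $c_{s,n}>0$ be any normalization constant, and for $U:\mathbb R^n\to\mathbb R$ let $$(-\Delta)^sU(x)=c_{s,n}\int_{\mathbb R^n}\frac{U(x)-U(y)}{|x-y|^{n+2s}}\,dy,$$ the integral being the limit as $\varepsilon\to0^+$ of the absolutely convergent integrals over $\{|x-y|>\varepsilon\}$, and for $s<\frac12$ also an absolutely convergent integral over $\mathbb R^n$. Let $u$ be a real $C^2$ function on $(0,\infty)$ with $$\int_0^\infty \frac{|u(r)|}{(1+r)^{n+2s}}\,r^{n-1}\,dr<\infty ,$$ and let $U(x)=u(|x|)$ be the corresponding radial function on $\mathbb R^n$ (with an arbitrary value at $0$). Then for every $x\neq 0$, with $r=|x|$, $(-\Delta)^sU(x)$ exists in the above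 sense and $$(-\Delta)^sU(x)=c_{s,n}\,r^{-2s}\int_1^\infty\Big(u(r)-u(r\tau)+\big(u(r)-u(r/\tau)\big)\tau^{-n+2s}\Big)\,\tau(\tau^2-1)^{-1-2s}H(\tau)\,d\tau,$$ where the integral on the right converges absolutely. (2) $H$ is positive and continuous on $[1,\infty)$, and $H(\tau)\simeq\tau^{2s}$ as $\tau\to\infty$ (the ratio of the two sides stays between two positive constants for large $\tau$). Moreover, for $\tau>1$, $$\tau(\tau^2-1)^{-1-2s}H(\tau)=\frac{2\pi^{n/2}}{\Gamma(n/2)}\,\tau^{-1-2s}\,{}_2F_1\Big(\frac{n+2s}{2},\,1+s;\,\frac n2;\,\tau^{-2}\Big),$$ and there are positive constants $C_1,C_2$ depending only on $n$ and $s$ such that $C_1(\tau-1)^{-1-2s}\le\tau(\tau^2-1)^{-1-2s}H(\tau)\le C_2(\tau-1)^{-1-2s}$ for all $\tau>1$. -/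

import Mathlib

open MeasureTheory Set Filter Topology Asymptotics

noncomputable section

namespace RadialFracLap

/-- The integrand `(U x - U y) / |x - y| ^ (n + 2 s)` of the fractional Laplacian on `ℝⁿ`. -/
def fracIntegrand {n : ℕ} (s : ℝ) (U : EuclideanSpace ℝ (Fin n) → ℝ)
    (x y : EuclideanSpace ℝ (Fin n)) : ℝ :=
  (U x - U y) / ‖x - y‖ ^ ((n : ℝ) + 2 * s)

/-- `(-Δ)^s U (x)`, with normalization constant `c`, exists and has the value `L`:
the integral of `c (U x - U y) / |x - y| ^ (n + 2 s)` over `ℝⁿ` converges to `L` in the principal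
value sense (each truncated integral being absolutely convergent), and, when `s < 1 / 2`, it also
converges to `L` as a Lebesgue integral. -/
def HasFracLaplacianAt {n : ℕ} (c s : ℝ) (U : EuclideanSpace ℝ (Fin n) → ℝ)
    (x : EuclideanSpace ℝ (Fin n)) (L : ℝ) : Prop :=
  (∀ ε : ℝ, 0 < ε → IntegrableOn (fracIntegrand s U x) {y | ε < ‖x - y‖} volume) ∧
  Tendsto (fun ε : ℝ => c * ∫ y in {y | ε < ‖x - y‖}, fracIntegrand s U x y) (𝓝[>] 0) (𝓝 L) ∧
  (s < 1 / 2 →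
    Integrable (fracIntegrand s U x) volume ∧ c * ∫ y, fracIntegrand s U x y = L)

/-- `α_n = π ^ ((n - 3) / 2) / Γ((n - 1) / 2)`. -/
def alpha (n : ℕ) : ℝ :=
  Real.pi ^ (((n : ℝ) - 3) / 2) / Real.Gamma (((n : ℝ) - 1) / 2)

/-- The kernel `H(τ)`, for `n ≥ 2` and `τ ≥ 1`. -/
def H (n : ℕ) (s τ : ℝ) : ℝ :=
  2 * Real.pi * alpha n *
    ∫ θ in (0 : ℝ)..Real.pi,
      Real.sin θ ^ (n - 2) *
        ((√(τ ^ 2 - Real.sin θ ^ 2) + Real.cos θ) ^ (1 + 2 * s) / √(τ ^ 2 - Real.sin θ ^ 2))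

/-- The integrand on `(1, ∞)` in the radial representation formula, for the profile `u`. -/
def radialIntegrand (n : ℕ) (s : ℝ) (u : ℝ → ℝ) (r τ : ℝ) : ℝ :=
  (u r - u (r * τ) + (u r - u (r / τ)) * τ ^ (-(n : ℝ) + 2 * s)) *
    (τ * (τ ^ 2 - 1) ^ (-1 - 2 * s) * H n s τ)

end RadialFracLap

end

/-! Put r = |x|, τ = |y|/r, let φ be the angle between x and y, and write Q(τ,φ) = 1 + τ² - 2τ cos
φ, so that |x-y|² = r² Q. Lebesgue measure becomes (rτ)^n dτ/τ times the unnormalized angular law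
(`map_polar`). A radial function does not see φ, and integrating φ out leaves a kernel in τ alone.
For τ > 1, replacing the angle φ at the origin by the angle θ at x/r gives this kernel its form in
terms of H (`kernel_eq`). The range τ < 1 is folded onto τ > 1 by τ ↦ 1/τ, which preserves dτ/τ;
since Q(1/τ,φ) = Q(τ,φ)/τ², the folding produces the weight τ^(-n+2s).

The folded difference vanishes to second order at τ = 1 while the kernel has size (τ-1)^(-1-2s), so
the radial integral converges absolutely for every s < 1 (`integrableOn_symDiff_mul_kern`). The
excised ball is not invariant under the inversion. With relative radius δ, the mismatch lies in a
shell of volume O(δ^(n+1)), where the unfolded difference is O(δ) and the singular factor is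
O(δ^(-n-2s)); it contributes O(δ^(2-2s)), which tends to 0 (`tendsto_integral_defect`). The
remaining part converges by domination, and `tendsto_truncated_integral` combines the two.

For the hypergeometric identity, M_μ(z) = ∫ sin^m φ (1 + z² - 2z cos φ)^(-μ) dφ is holomorphic in
the unit disc and satisfies z M_μ'' + (m+1) M_μ' = 2μ(2μ-m) z M_(μ+1) (`genInt_ode`). The Taylor
coefficients at 0 then obey a recursion shifting μ by one, solved by Pochhammer quotients in z². The
choice m = n-2, μ = (n+2s)/2, z = 1/τ gives the kernel. The size estimates for H come from bounding
its integrand by multiples of τ^(2s), uniformly down to τ = 1 (`le_H`, `H_le`). -/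

namespace RadialFracLap

open Real
open scoped RealInnerProductSpace ENNReal

/-! ### Size and continuity of H, and bounds for the kernel -/

/-- The singular factor of the integrand defining `H`. -/
noncomputable def angularFactor (s τ θ : ℝ) : ℝ :=
  (√(τ ^ 2 - sin θ ^ 2) + cos θ) ^ (1 + 2 * s) / √(τ ^ 2 - sin θ ^ 2)

lemma H_eq (n : ℕ) (s τ : ℝ) :
    H n s τ = 2 * π * alpha n * ∫ θ in (0 : ℝ)..π, sin θ ^ (n - 2) * angularFactor s τ θ := rfl

lemma alpha_pos {n : ℕ} (hn : 2 ≤ n) : 0 < alpha n := by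
  have hn' : (2 : ℝ) ≤ n := by exact_mod_cast hn
  exact div_pos (rpow_pos_of_pos pi_pos _) (Gamma_pos_of_pos (by linarith))

lemma abs_cos_le_sqrt {τ : ℝ} (hτ : 1 ≤ τ) (θ : ℝ) : |cos θ| ≤ √(τ ^ 2 - sin θ ^ 2) := by
  apply abs_le_sqrt
  nlinarith [sin_sq_add_cos_sq θ]

lemma sqrt_sub_sin_sq_le {τ : ℝ} (hτ : 1 ≤ τ) (θ : ℝ) : √(τ ^ 2 - sin θ ^ 2) ≤ τ :=
  sqrt_le_iff.2 ⟨by linarith, by nlinarith [sq_nonneg (sin θ)]⟩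

lemma mul_cos_le_sqrt {τ : ℝ} (hτ : 1 ≤ τ) (θ : ℝ) : τ * cos θ ≤ √(τ ^ 2 - sin θ ^ 2) := by
  apply le_sqrt_of_sq_le
  nlinarith [sin_sq_add_cos_sq θ, mul_nonneg (sub_nonneg.2 (one_le_pow₀ hτ (n := 2)))
    (sq_nonneg (sin θ))]

lemma angularFactor_nonneg {s τ : ℝ} (hτ : 1 ≤ τ) (θ : ℝ) : 0 ≤ angularFactor s τ θ := by
  have := neg_le_of_abs_le (abs_cos_le_sqrt hτ θ)
  exact div_nonneg (rpow_nonneg (by linarith) _) (sqrt_nonneg _)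

/-- With A the square root, |cos θ| ≤ A bounds the numerator by (2A)^(1+2s), which absorbs the
denominator. The case A = 0, possible only when τ = 1 and cos θ = 0, is covered by division by zero
being 0. -/
lemma angularFactor_le {s τ : ℝ} (hs : 0 < s) (hτ : 1 ≤ τ) (θ : ℝ) :
    angularFactor s τ θ ≤ 2 ^ (1 + 2 * s) * τ ^ (2 * s) := by
  have h1 := abs_le.1 (abs_cos_le_sqrt hτ θ)
  have h2 := sqrt_sub_sin_sq_le hτ θ
  unfold angularFactor
  set A := √(τ ^ 2 - sin θ ^ 2) with hA
  rcases (sqrt_nonneg (τ ^ 2 - sin θ ^ 2)).eq_or_lt with h0 | h0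
  · rw [hA, ← h0, div_zero]; positivity
  rw [← hA] at h0
  have h3 : (A + cos θ) ^ (1 + 2 * s) ≤ (2 * A) ^ (1 + 2 * s) :=
    rpow_le_rpow (by linarith) (by linarith) (by linarith)
  calc (A + cos θ) ^ (1 + 2 * s) / A ≤ (2 * A) ^ (1 + 2 * s) / A := by gcongr
    _ = 2 ^ (1 + 2 * s) * A ^ (2 * s) := by
        rw [mul_rpow (by norm_num) h0.le, rpow_add h0, rpow_one]; field_simp
    _ ≤ _ := by gcongr

lemma le_angularFactor {s τ : ℝ} (hs : 0 < s) (hτ : 1 ≤ τ) {θ : ℝ} (hθ : 0 ≤ cos θ) :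
    τ ^ (2 * s) * cos θ ^ (2 * s) ≤ angularFactor s τ θ := by
  have h1 := mul_cos_le_sqrt hτ θ
  unfold angularFactor
  set A := √(τ ^ 2 - sin θ ^ 2) with hA
  rw [← mul_rpow (by linarith) hθ]
  have h4 : 0 ≤ τ * cos θ := mul_nonneg (by linarith) hθ
  rcases (sqrt_nonneg (τ ^ 2 - sin θ ^ 2)).eq_or_lt with h0 | h0
  · rw [← hA] at h0
    have : τ * cos θ = 0 := by linarith
    rw [this, ← h0, div_zero, zero_rpow (by linarith)]
  rw [← hA] at h0
  calc (τ * cos θ) ^ (2 * s) ≤ A ^ (2 * s) := rpow_le_rpow h4 h1 (by linarith)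
    _ = A ^ (1 + 2 * s) / A := by rw [rpow_add h0, rpow_one]; field_simp
    _ ≤ _ := by
      gcongr
      linarith

lemma measurable_angularFactor (s τ : ℝ) : Measurable (angularFactor s τ) := by
  unfold angularFactor; fun_prop

lemma intervalIntegrable_of_bounded {f : ℝ → ℝ} {a b C : ℝ} (hf : Measurable f)
    (hC : ∀ x, |f x| ≤ C) : IntervalIntegrable f volume a b := by
  apply (intervalIntegrable_const (c := C)).mono_fun hf.aestronglyMeasurable
  exact Eventually.of_forall fun x => (hC x).trans (le_abs_self C)

lemma abs_sin_pow_mul_angularFactor_le {s τ : ℝ} (hs : 0 < s) (hτ : 1 ≤ τ) (m : ℕ) (θ : ℝ) :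
    |sin θ ^ m * angularFactor s τ θ| ≤ 2 ^ (1 + 2 * s) * τ ^ (2 * s) := by
  rw [abs_mul, abs_pow, abs_of_nonneg (angularFactor_nonneg hτ θ)]
  calc _ ≤ 1 * angularFactor s τ θ := by
        gcongr
        · exact angularFactor_nonneg hτ θ
        · exact pow_le_one₀ (abs_nonneg _) (abs_sin_le_one θ)
    _ ≤ _ := by rw [one_mul]; exact angularFactor_le hs hτ θ

lemma intervalIntegrable_sin_pow_mul_angularFactor {s τ : ℝ} (hs : 0 < s) (hτ : 1 ≤ τ) (m : ℕ)
    (a b : ℝ) : IntervalIntegrable (fun θ => sin θ ^ m * angularFactor s τ θ) volume a b :=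
  intervalIntegrable_of_bounded (by have := measurable_angularFactor s τ; fun_prop)
    (abs_sin_pow_mul_angularFactor_le hs hτ m)

lemma H_le {n : ℕ} (hn : 2 ≤ n) {s : ℝ} (hs : 0 < s) :
    ∃ C, 0 < C ∧ ∀ τ, 1 ≤ τ → H n s τ ≤ C * τ ^ (2 * s) := by
  have ha := alpha_pos hn
  refine ⟨2 * π * alpha n * (π * 2 ^ (1 + 2 * s)), by positivity, fun τ hτ => ?_⟩
  rw [H_eq, mul_assoc (2 * π * alpha n)]
  gcongr
  calc ∫ θ in (0 : ℝ)..π, sin θ ^ (n - 2) * angularFactor s τ θ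
      ≤ ∫ θ in (0 : ℝ)..π, 2 ^ (1 + 2 * s) * τ ^ (2 * s) := by
        apply intervalIntegral.integral_mono_on pi_pos.le
          (intervalIntegrable_sin_pow_mul_angularFactor hs hτ _ _ _) intervalIntegrable_const
        exact fun θ _ => (le_abs_self _).trans (abs_sin_pow_mul_angularFactor_le hs hτ _ θ)
    _ = _ := by rw [intervalIntegral.integral_const]; simp; ring

/-- On (0, π/2) the integrand dominates τ^(2s) times a positive function of θ alone; on (π/2, π)
nonnegativity suffices. -/
lemma le_H {n : ℕ} (hn : 2 ≤ n) {s : ℝ} (hs : 0 < s) :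
    ∃ c, 0 < c ∧ ∀ τ, 1 ≤ τ → c * τ ^ (2 * s) ≤ H n s τ := by
  have ha := alpha_pos hn
  have hcont : Continuous fun θ : ℝ => sin θ ^ (n - 2) * cos θ ^ (2 * s) :=
    (continuous_sin.pow _).mul (continuous_cos.rpow_const fun _ => Or.inr (by linarith))
  have hpos : 0 < ∫ θ in (0 : ℝ)..(π / 2), sin θ ^ (n - 2) * cos θ ^ (2 * s) := by
    apply intervalIntegral.intervalIntegral_pos_of_pos_on (hcont.intervalIntegrable _ _) _
      (by positivity)
    intro θ hθ
    have h1 := sin_pos_of_pos_of_lt_pi hθ.1 (by linarith [hθ.2, pi_pos])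
    have h2 := cos_pos_of_mem_Ioo ⟨by linarith [hθ.1, pi_pos], hθ.2⟩
    positivity
  refine ⟨2 * π * alpha n * ∫ θ in (0 : ℝ)..(π / 2), sin θ ^ (n - 2) * cos θ ^ (2 * s),
    by positivity, fun τ hτ => ?_⟩
  have hI := fun a b => intervalIntegrable_sin_pow_mul_angularFactor hs hτ (n - 2) a b
  rw [H_eq, mul_assoc (2 * π * alpha n)]
  gcongr
  rw [← intervalIntegral.integral_add_adjacent_intervals (hI 0 (π / 2)) (hI (π / 2) π),
    ← intervalIntegral.integral_mul_const]
  refine le_add_of_le_of_nonneg ?_ ?_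
  · apply intervalIntegral.integral_mono_on (by positivity)
      ((hcont.mul continuous_const).intervalIntegrable _ _) (hI _ _)
    intro θ hθ
    have h1 := sin_nonneg_of_nonneg_of_le_pi hθ.1 (by linarith [hθ.2, pi_pos])
    have h2 := cos_nonneg_of_mem_Icc ⟨by linarith [hθ.1, pi_pos], hθ.2⟩
    change sin θ ^ (n - 2) * cos θ ^ (2 * s) * τ ^ (2 * s) ≤ _
    rw [mul_assoc]
    gcongr
    rw [mul_comm]
    exact le_angularFactor hs hτ h2
  · apply intervalIntegral.integral_nonneg (by linarith [pi_pos])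
    intro θ hθ
    have h1 := sin_nonneg_of_nonneg_of_le_pi (by linarith [hθ.1, pi_pos]) hθ.2
    exact mul_nonneg (pow_nonneg h1 _) (angularFactor_nonneg hτ θ)

lemma H_pos {n : ℕ} (hn : 2 ≤ n) {s : ℝ} (hs : 0 < s) {τ : ℝ} (hτ : 1 ≤ τ) : 0 < H n s τ := by
  obtain ⟨c, hc, h⟩ := le_H hn hs
  exact lt_of_lt_of_le (mul_pos hc (rpow_pos_of_pos (by linarith) _)) (h τ hτ)

lemma H_isTheta {n : ℕ} (hn : 2 ≤ n) {s : ℝ} (hs : 0 < s) :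
    H n s =Θ[atTop] fun τ : ℝ => τ ^ (2 * s) := by
  obtain ⟨c, hc, h⟩ := le_H hn hs
  obtain ⟨C, hC, h'⟩ := H_le hn hs
  constructor
  · refine IsBigO.of_bound C ?_
    filter_upwards [eventually_ge_atTop 1] with τ hτ
    rw [norm_of_nonneg (H_pos hn hs hτ).le, norm_of_nonneg (by positivity)]
    exact h' τ hτ
  · refine IsBigO.of_bound c⁻¹ ?_
    filter_upwards [eventually_ge_atTop 1] with τ hτ
    rw [norm_of_nonneg (H_pos hn hs hτ).le, norm_of_nonneg (by positivity),
      le_inv_mul_iff₀ hc]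
    exact h τ hτ

lemma continuousOn_H (n : ℕ) {s : ℝ} (hs : 0 < s) : ContinuousOn (H n s) (Ici 1) := by
  intro τ₀ hτ₀
  apply ContinuousWithinAt.mul continuousWithinAt_const
  apply intervalIntegral.continuousWithinAt_of_dominated_interval
    (bound := fun _ => 2 ^ (1 + 2 * s) * (τ₀ + 1) ^ (2 * s))
  · exact Eventually.of_forall fun τ => Measurable.aestronglyMeasurable
      (by have := measurable_angularFactor s τ; unfold angularFactor at this; fun_prop)
  · filter_upwards [self_mem_nhdsWithin, mem_nhdsWithin_of_mem_nhds
      (Iio_mem_nhds (lt_add_one τ₀))] with τ hτ hτ'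
    rw [mem_Ici] at hτ
    rw [mem_Iio] at hτ'
    refine Eventually.of_forall fun θ _ => ?_
    refine (abs_sin_pow_mul_angularFactor_le hs hτ _ θ).trans ?_
    gcongr
  · exact intervalIntegrable_const
  · have : ∀ᵐ θ : ℝ, θ ≠ π / 2 := by simp [ae_iff]
    filter_upwards [this] with θ hθ hθ'
    rw [uIoc_of_le pi_pos.le] at hθ'
    have hcos : cos θ ≠ 0 := by
      intro h
      exact hθ (injOn_cos ⟨hθ'.1.le, hθ'.2⟩ ⟨by positivity, by linarith [pi_pos]⟩
        (by rw [h, cos_pi_div_two]))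
    have hne : √(τ₀ ^ 2 - sin θ ^ 2) ≠ 0 :=
      ((abs_pos.2 hcos).trans_le (abs_cos_le_sqrt hτ₀ θ)).ne'
    have hc : ContinuousAt (fun τ : ℝ => √(τ ^ 2 - sin θ ^ 2)) τ₀ := by fun_prop
    refine ContinuousAt.continuousWithinAt ?_
    refine continuousAt_const.mul (ContinuousAt.div ?_ hc hne)
    exact (hc.add continuousAt_const).rpow_const (Or.inr (by linarith))

lemma rpow_sq_sub_one {τ : ℝ} (hτ : 1 < τ) (a : ℝ) :
    (τ ^ 2 - 1) ^ a = (τ - 1) ^ a * (τ + 1) ^ a := by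
  rw [← mul_rpow (by linarith) (by linarith)]; congr 1; ring

/-- Since H is comparable to τ^(2s) on all of [1, ∞), splitting τ² - 1 leaves only
((τ+1)/τ)^(-1-2s), which lies between 2^(-1-2s) and 1. -/
lemma kernel_bounds {n : ℕ} (hn : 2 ≤ n) {s : ℝ} (hs : 0 < s) :
    ∃ C₁ C₂ : ℝ, 0 < C₁ ∧ 0 < C₂ ∧ ∀ τ : ℝ, 1 < τ →
      C₁ * (τ - 1) ^ (-1 - 2 * s) ≤ τ * (τ ^ 2 - 1) ^ (-1 - 2 * s) * H n s τ ∧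
      τ * (τ ^ 2 - 1) ^ (-1 - 2 * s) * H n s τ ≤ C₂ * (τ - 1) ^ (-1 - 2 * s) := by
  obtain ⟨c, hc, h⟩ := le_H hn hs
  obtain ⟨C, hC, h'⟩ := H_le hn hs
  refine ⟨2 ^ (-1 - 2 * s) * c, C, by positivity, hC, fun τ hτ => ?_⟩
  have h0 : 0 < τ := by linarith
  have hk : ∀ D : ℝ, τ * (τ ^ 2 - 1) ^ (-1 - 2 * s) * (D * τ ^ (2 * s)) =
      ((τ + 1) / τ) ^ (-1 - 2 * s) * D * (τ - 1) ^ (-1 - 2 * s) := by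
    intro D
    rw [rpow_sq_sub_one hτ, div_rpow (by linarith) h0.le]
    have : τ ^ (-1 - 2 * s) = (τ * τ ^ (2 * s))⁻¹ := by
      rw [show -1 - 2 * s = -(1 + 2 * s) by ring, rpow_neg h0.le, rpow_add h0, rpow_one]
    rw [this]
    field_simp
  have hpos : 0 ≤ τ * (τ ^ 2 - 1) ^ (-1 - 2 * s) :=
    mul_nonneg h0.le (rpow_nonneg (by nlinarith) _)
  have hneg : -1 - 2 * s ≤ 0 := by linarith
  constructor
  · refine le_trans ?_ (mul_le_mul_of_nonneg_left (h τ hτ.le) hpos)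
    rw [hk]
    have : (0 : ℝ) ≤ (τ - 1) ^ (-1 - 2 * s) := rpow_nonneg (by linarith) _
    gcongr ?_ * c * _
    apply rpow_le_rpow_of_nonpos (by positivity) _ hneg
    rw [div_le_iff₀ h0]; linarith
  · refine (mul_le_mul_of_nonneg_left (h' τ hτ.le) hpos).trans ?_
    rw [hk]
    have : (0 : ℝ) ≤ (τ - 1) ^ (-1 - 2 * s) := rpow_nonneg (by linarith) _
    gcongr
    apply mul_le_of_le_one_left hC.le
    apply rpow_le_one_of_one_le_of_nonpos _ hneg
    rw [le_div_iff₀ h0]; linarith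

/-! ### From the angle at the origin to the angle at the unit vector -/

lemma sin_sq_lt_sq {τ : ℝ} (hτ : 1 < τ) (θ : ℝ) : 0 < τ ^ 2 - sin θ ^ 2 := by
  nlinarith [sin_sq_add_cos_sq θ, sq_nonneg (cos θ)]

/-- In the triangle 0, e, y with |e| = 1 and |y| = τ, let θ be the exterior angle at e. The law of
sines makes arcsin(sin θ/τ) the angle at y, so the difference is the angle φ at the origin. -/
lemma hasDerivAt_sub_arcsin {τ : ℝ} (hτ : 1 < τ) (θ : ℝ) :
    HasDerivAt (fun θ => θ - arcsin (sin θ / τ))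
      ((√(τ ^ 2 - sin θ ^ 2) - cos θ) / √(τ ^ 2 - sin θ ^ 2)) θ := by
  have h0 : 0 < τ := by linarith
  have hA := sqrt_pos.2 (sin_sq_lt_sq hτ θ)
  have h1 : |sin θ / τ| < 1 := by
    rw [abs_div, abs_of_pos h0, div_lt_one h0]
    exact (abs_sin_le_one θ).trans_lt hτ
  have h2 := abs_lt.1 h1
  have hd := (hasDerivAt_arcsin h2.1.ne' h2.2.ne).comp θ ((hasDerivAt_sin θ).div_const τ)
  have hA' : √(1 - (sin θ / τ) ^ 2) = √(τ ^ 2 - sin θ ^ 2) / τ := by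
    rw [show 1 - (sin θ / τ) ^ 2 = (τ ^ 2 - sin θ ^ 2) / τ ^ 2 by field_simp,
      sqrt_div (sin_sq_lt_sq hτ θ).le, sqrt_sq h0.le]
  refine ((hasDerivAt_id θ).sub hd).congr_deriv ?_
  rw [hA']
  field_simp

/-- These are the laws of cosines and sines in the same triangle, whose side |y - e| is √(τ² - sin²
θ) - cos θ. -/
lemma cos_sub_arcsin {τ : ℝ} (hτ : 1 < τ) (θ : ℝ) :
    1 + τ ^ 2 - 2 * τ * cos (θ - arcsin (sin θ / τ)) = (√(τ ^ 2 - sin θ ^ 2) - cos θ) ^ 2 ∧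
    sin (θ - arcsin (sin θ / τ)) = sin θ * (√(τ ^ 2 - sin θ ^ 2) - cos θ) / τ := by
  have h0 : 0 < τ := by linarith
  have h1 : |sin θ / τ| ≤ 1 := by
    rw [abs_div, abs_of_pos h0, div_le_one h0]
    exact (abs_sin_le_one θ).trans hτ.le
  have h2 := abs_le.1 h1
  have hA' : √(1 - (sin θ / τ) ^ 2) = √(τ ^ 2 - sin θ ^ 2) / τ := by
    rw [show 1 - (sin θ / τ) ^ 2 = (τ ^ 2 - sin θ ^ 2) / τ ^ 2 by field_simp,
      sqrt_div (sin_sq_lt_sq hτ θ).le, sqrt_sq h0.le]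
  rw [cos_sub, sin_sub, cos_arcsin, sin_arcsin h2.1 h2.2, hA']
  have hsq := sq_sqrt (sin_sq_lt_sq hτ θ).le
  set A := √(τ ^ 2 - sin θ ^ 2)
  constructor
  · field_simp
    linear_combination -hsq - sin_sq_add_cos_sq θ
  · field_simp

/-- The squared distance `1 + τ² - 2 τ cos φ` between a unit vector and a vector of norm `τ`
at angle `φ`. -/
noncomputable def distSq (τ φ : ℝ) : ℝ := 1 + τ ^ 2 - 2 * τ * cos φ

lemma sub_one_sq_le_distSq {τ : ℝ} (hτ : 0 ≤ τ) (φ : ℝ) : (τ - 1) ^ 2 ≤ distSq τ φ := by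
  unfold distSq
  nlinarith [cos_le_one φ]

lemma distSq_pos {τ : ℝ} (hτ : 0 ≤ τ) (h1 : τ ≠ 1) (φ : ℝ) : 0 < distSq τ φ :=
  (sq_pos_of_ne_zero (sub_ne_zero.2 h1)).trans_le (sub_one_sq_le_distSq hτ φ)

@[fun_prop]
lemma continuous_distSq : Continuous fun p : ℝ × ℝ => distSq p.1 p.2 := by
  unfold distSq; fun_prop

/-- Substitution of the angle seen from the origin by the angle seen from the unit vector. -/
lemma integral_sin_pow_mul_distSq {τ : ℝ} (hτ : 1 < τ) {n : ℕ} (hn : 2 ≤ n) (s : ℝ) :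
    τ ^ (n - 2) * ∫ φ in (0 : ℝ)..π, sin φ ^ (n - 2) * distSq τ φ ^ (-(((n : ℝ) + 2 * s) / 2)) =
      (τ ^ 2 - 1) ^ (-1 - 2 * s) *
        ∫ θ in (0 : ℝ)..π, sin θ ^ (n - 2) * angularFactor s τ θ := by
  have h0 : 0 < τ := by linarith
  obtain ⟨m, rfl⟩ : ∃ m, n = m + 2 := ⟨n - 2, by omega⟩
  simp only [Nat.add_sub_cancel]
  have hsub := intervalIntegral.integral_comp_mul_deriv (a := 0) (b := π)
    (f := fun θ => θ - arcsin (sin θ / τ))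
    (f' := fun θ => (√(τ ^ 2 - sin θ ^ 2) - cos θ) / √(τ ^ 2 - sin θ ^ 2))
    (g := fun φ => sin φ ^ m * distSq τ φ ^ (-((((m + 2 : ℕ) : ℝ) + 2 * s) / 2)))
    (fun θ _ => hasDerivAt_sub_arcsin hτ θ) ?_ ?_
  · simp only [sin_zero, zero_div, arcsin_zero, sin_pi, sub_zero] at hsub
    rw [← hsub, ← intervalIntegral.integral_const_mul, ← intervalIntegral.integral_const_mul]
    congr 1
    ext θ
    obtain ⟨h1, h2⟩ := cos_sub_arcsin hτ θ
    simp only [Function.comp, distSq, h1, h2, angularFactor]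
    have hA := sqrt_pos.2 (sin_sq_lt_sq hτ θ)
    have hsq := sq_sqrt (sin_sq_lt_sq hτ θ).le
    have hcA : |cos θ| < √(τ ^ 2 - sin θ ^ 2) := by
      apply lt_sqrt_of_sq_lt
      rw [sq_abs]
      nlinarith [sin_sq_add_cos_sq θ]
    have hc := abs_lt.1 hcA
    set A := √(τ ^ 2 - sin θ ^ 2)
    have hd : 0 < A - cos θ := by linarith
    have hd' : 0 < A + cos θ := by linarith
    -- The powers of the distance A - cos θ combine to exponent -1-2s; this factorization trades
    -- them for powers of τ² - 1 and A + cos θ.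
    have hmul : τ ^ 2 - 1 = (A - cos θ) * (A + cos θ) := by
      linear_combination -hsq + sin_sq_add_cos_sq θ
    rw [hmul, mul_rpow hd.le hd'.le, ← rpow_natCast (A - cos θ) 2, ← rpow_mul hd.le,
      show -1 - 2 * s = -(1 + 2 * s) by ring, rpow_neg hd'.le]
    have e : (A - cos θ) ^ (-(1 + 2 * s)) = (A - cos θ) ^ m *
        (A - cos θ) ^ ((2 : ℕ) * -((((m + 2 : ℕ) : ℝ) + 2 * s) / 2)) * (A - cos θ) := by
      rw [← rpow_natCast, ← rpow_add hd]
      conv_rhs => rw [← rpow_one (A - cos θ)]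
      rw [← rpow_mul hd.le, ← rpow_add hd]
      congr 1
      push_cast
      ring
    rw [e]
    have := (rpow_pos_of_pos hd' (1 + 2 * s)).ne'
    field_simp
    rw [← mul_pow, ← mul_pow]
    congr 1
    field_simp
  · apply Continuous.continuousOn
    exact Continuous.div (by fun_prop) (by fun_prop)
      fun θ => (sqrt_pos.2 (sin_sq_lt_sq hτ θ)).ne'
  · refine (continuous_sin.pow _).mul (Continuous.rpow_const ?_ ?_)
    · unfold distSq; fun_prop
    · exact fun φ => Or.inl (distSq_pos h0.le hτ.ne' φ).ne'

lemma kernel_eq {τ : ℝ} (hτ : 1 < τ) {n : ℕ} (hn : 2 ≤ n) (s : ℝ) :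
    τ * (τ ^ 2 - 1) ^ (-1 - 2 * s) * H n s τ = 2 * π * alpha n * τ ^ (n - 1) *
      ∫ φ in (0 : ℝ)..π, sin φ ^ (n - 2) * distSq τ φ ^ (-(((n : ℝ) + 2 * s) / 2)) := by
  have h := integral_sin_pow_mul_distSq hτ hn s
  rw [H_eq, show n - 1 = n - 2 + 1 by omega, pow_succ τ (n - 2)]
  linear_combination (-2 * π * alpha n * τ) * h

/-! ### Holomorphic angular integrals and their Taylor coefficients -/

/-- The polynomial `1 + z² - 2 z cos φ` for complex `z`. -/
noncomputable def genPoly (z : ℂ) (φ : ℝ) : ℂ := 1 + z ^ 2 - 2 * z * (cos φ : ℝ)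

/-- The integral `∫ w(φ) (1 + z² - 2 z cos φ) ^ (-μ) dφ` over `(0, π)`. -/
noncomputable def genInt (w : ℝ → ℂ) (μ : ℂ) (z : ℂ) : ℂ :=
  ∫ φ in (0 : ℝ)..π, w φ * genPoly z φ ^ (-μ)

/-- The imaginary part 2 Im z (Re z - cos φ) vanishes only if z is real or Re z = cos φ; in the
latter case the real part is 1 - |z|², and in both it is positive. -/
lemma genPoly_mem_slitPlane {z : ℂ} (hz : z ∈ Metric.ball (0 : ℂ) 1) (φ : ℝ) :
    genPoly z φ ∈ Complex.slitPlane := by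
  rw [mem_ball_zero_iff] at hz
  have hz' : z.re ^ 2 + z.im ^ 2 < 1 := by
    have := Complex.sq_norm z
    rw [Complex.normSq_apply] at this
    nlinarith [norm_nonneg z]
  rw [Complex.mem_slitPlane_iff]
  by_contra! h
  obtain ⟨h1, h2⟩ := h
  have e1 : (genPoly z φ).re = 1 + z.re ^ 2 - z.im ^ 2 - 2 * z.re * cos φ := by
    simp [genPoly, pow_two, -Complex.ofReal_cos]; ring
  have e2 : (genPoly z φ).im = 2 * z.im * (z.re - cos φ) := by
    simp [genPoly, pow_two, -Complex.ofReal_cos]; ring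
  rw [e1] at h1
  rw [e2] at h2
  rcases mul_eq_zero.1 h2 with h3 | h3
  · have : z.im = 0 := by linarith
    rw [this] at h1 hz'
    nlinarith [cos_le_one φ, neg_one_le_cos φ, sin_sq_add_cos_sq φ, sq_nonneg (z.re - cos φ),
      sq_nonneg (sin φ), sq_nonneg (z.re)]
  · have : cos φ = z.re := by linarith
    rw [this] at h1
    nlinarith

lemma continuous_genPoly : Continuous fun p : ℂ × ℝ => genPoly p.1 p.2 := by
  unfold genPoly; fun_prop

lemma hasDerivAt_genPoly (z : ℂ) (φ : ℝ) :
    HasDerivAt (fun z => genPoly z φ) (2 * z - 2 * (cos φ : ℝ)) z := by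
  unfold genPoly
  have h := (((hasDerivAt_id z).pow 2).const_add 1).sub
    (((hasDerivAt_id z).const_mul 2).mul_const ((cos φ : ℝ) : ℂ))
  refine h.congr_deriv ?_
  simp

lemma continuousOn_genPoly_cpow (μ : ℂ) :
    ContinuousOn (fun p : ℂ × ℝ => genPoly p.1 p.2 ^ μ) (Metric.ball 0 1 ×ˢ univ) := by
  intro p hp
  exact (continuous_genPoly.continuousAt.cpow continuousAt_const
    (genPoly_mem_slitPlane hp.1 p.2)).continuousWithinAt

lemma continuous_mul_genPoly_cpow {w : ℝ → ℂ} (hw : Continuous w) (μ : ℂ) {z : ℂ}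
    (hz : z ∈ Metric.ball (0 : ℂ) 1) : Continuous fun φ => w φ * genPoly z φ ^ μ := by
  refine hw.mul (Continuous.cpow ?_ continuous_const ?_)
  · exact continuous_genPoly.comp (by fun_prop : Continuous fun φ : ℝ => (z, φ))
  · exact fun φ => genPoly_mem_slitPlane hz φ

/-- Differentiation under the integral, dominated by the maximum of the derivative over a compact
ball times [0, π]. -/
lemma hasDerivAt_genInt {w : ℝ → ℂ} (hw : Continuous w) (μ : ℂ) {z : ℂ}
    (hz : z ∈ Metric.ball (0 : ℂ) 1) :
    HasDerivAt (genInt w μ)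
      (-2 * μ * (z * genInt w (μ + 1) z - genInt (fun φ => w φ * (cos φ : ℝ)) (μ + 1) z)) z := by
  have hz1 := mem_ball_zero_iff.1 hz
  obtain ⟨R, hzR, hR⟩ := exists_between hz1
  have hsub : Metric.closedBall (0 : ℂ) R ⊆ Metric.ball 0 1 := Metric.closedBall_subset_ball hR
  set F' : ℂ → ℝ → ℂ := fun z φ => w φ * (-μ * genPoly z φ ^ (-μ - 1) * (2 * z - 2 * (cos φ : ℝ)))
  have hF' : ContinuousOn (fun p : ℂ × ℝ => F' p.1 p.2) (Metric.ball 0 1 ×ˢ univ) := by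
    refine (hw.comp continuous_snd).continuousOn.mul ((continuousOn_const.mul
      (continuousOn_genPoly_cpow _)).mul (by fun_prop))
  obtain ⟨C, hC⟩ := ((isCompact_closedBall (0 : ℂ) R).prod
    (isCompact_Icc (a := (0 : ℝ)) (b := π))).exists_bound_of_continuousOn
    (hF'.mono (prod_mono hsub (subset_univ _)))
  have hF'z : Continuous (F' z) := by
    have : Continuous fun φ => (w φ * (-μ) * (2 * z - 2 * (cos φ : ℝ))) * genPoly z φ ^ (-μ - 1) :=
      continuous_mul_genPoly_cpow (by fun_prop) _ hz
    convert this using 2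
    simp only [F']; ring
  have key := intervalIntegral.hasDerivAt_integral_of_dominated_loc_of_deriv_le (𝕜 := ℂ)
    (μ := volume) (a := 0) (b := π)
    (F := fun z φ => w φ * genPoly z φ ^ (-μ)) (F' := F') (x₀ := z) (s := Metric.ball 0 R)
    (bound := fun _ => C)
    (Metric.isOpen_ball.mem_nhds (mem_ball_zero_iff.2 hzR)) ?_ ?_ ?_ ?_ ?_ ?_
  · refine key.2.congr_deriv ?_
    have h1 := (continuous_mul_genPoly_cpow hw (-(μ + 1)) hz).intervalIntegrable (μ := volume) 0 π
    have h2 := (continuous_mul_genPoly_cpow (w := fun φ => w φ * (cos φ : ℝ)) (by fun_prop)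
      (-(μ + 1)) hz).intervalIntegrable (μ := volume) 0 π
    unfold genInt
    rw [← intervalIntegral.integral_const_mul, ← intervalIntegral.integral_sub
      (h1.const_mul _) h2, ← intervalIntegral.integral_const_mul]
    congr 1
    ext φ
    simp only [F', neg_add']
    ring
  · filter_upwards [Metric.isOpen_ball.mem_nhds hz] with y hy
    exact (continuous_mul_genPoly_cpow hw _ hy).aestronglyMeasurable
  · exact (continuous_mul_genPoly_cpow hw _ hz).intervalIntegrable _ _
  · exact hF'z.aestronglyMeasurable
  · refine Eventually.of_forall fun φ hφ y hy => hC (y, φ) ⟨Metric.ball_subset_closedBall hy, ?_⟩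
    rw [uIoc_of_le pi_pos.le] at hφ
    exact ⟨hφ.1.le, hφ.2⟩
  · exact intervalIntegrable_const
  · refine Eventually.of_forall fun φ hφ y hy => ?_
    have hy' := hsub (Metric.ball_subset_closedBall hy)
    exact ((hasDerivAt_genPoly y φ).cpow_const (genPoly_mem_slitPlane hy' φ)).const_mul _

lemma hasDerivAt_genPoly_angle (z : ℂ) (φ : ℝ) :
    HasDerivAt (fun φ : ℝ => genPoly z φ) (2 * z * (sin φ : ℝ)) φ := by
  unfold genPoly
  have h := ((hasDerivAt_cos φ).ofReal_comp.const_mul (2 * z)).const_sub (1 + z ^ 2)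
  refine h.congr_deriv ?_
  push_cast
  ring

/-- Integration by parts in the angle. -/
lemma genInt_sin_pow_mul_cos (m : ℕ) (μ : ℂ) {z : ℂ} (hz : z ∈ Metric.ball (0 : ℂ) 1) :
    (m + 1) * genInt (fun φ => (sin φ : ℝ) ^ m * (cos φ : ℝ)) μ z =
      2 * μ * z * genInt (fun φ => (sin φ : ℝ) ^ (m + 2)) (μ + 1) z := by
  have hc1 := continuous_mul_genPoly_cpow (w := fun φ => (sin φ : ℝ) ^ m * (cos φ : ℝ))
    (by fun_prop) (-μ) hz
  have hc2 := continuous_mul_genPoly_cpow (w := fun φ => ((sin φ : ℝ) : ℂ) ^ (m + 2))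
    (by fun_prop) (-(μ + 1)) hz
  -- The exponent m + 1 ≥ 1 on the sine kills both boundary terms.
  have key := intervalIntegral.integral_eq_sub_of_hasDerivAt (a := 0) (b := π)
    (f := fun φ : ℝ => ((sin φ : ℝ) : ℂ) ^ (m + 1) * genPoly z φ ^ (-μ))
    (f' := fun φ => (m + 1) * (((sin φ : ℝ) : ℂ) ^ m * (cos φ : ℝ) * genPoly z φ ^ (-μ)) -
      2 * μ * z * (((sin φ : ℝ) : ℂ) ^ (m + 2) * genPoly z φ ^ (-(μ + 1)))) ?_ ?_
  · rw [intervalIntegral.integral_sub ((hc1.const_mul _).intervalIntegrable _ _)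
      ((hc2.const_mul _).intervalIntegrable _ _), intervalIntegral.integral_const_mul,
      intervalIntegral.integral_const_mul] at key
    simp only [sin_pi, sin_zero, Complex.ofReal_zero, zero_pow (Nat.succ_ne_zero m), zero_mul,
      sub_zero] at key
    exact sub_eq_zero.1 key
  · intro φ _
    have h1 := ((hasDerivAt_sin φ).ofReal_comp.pow (m + 1)).mul
      (((hasDerivAt_id (genPoly z φ)).cpow_const (c := -μ) (genPoly_mem_slitPlane hz φ)).scomp φ
        (hasDerivAt_genPoly_angle z φ))
    refine h1.congr_deriv ?_
    rw [neg_add']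
    push_cast
    simp only [Pi.pow_apply, Function.comp, id, smul_eq_mul]
    ring
  · exact ((hc1.const_mul _).sub (hc2.const_mul _)).intervalIntegrable _ _

/-- Pointwise, z² - 2z cos φ + cos² φ = (1 + z² - 2z cos φ) - sin² φ, and the first term lowers the
exponent by one. -/
lemma genInt_quadratic (m : ℕ) (μ : ℂ) {z : ℂ} (hz : z ∈ Metric.ball (0 : ℂ) 1) :
    z ^ 2 * genInt (fun φ => (sin φ : ℝ) ^ m) (μ + 1) z -
      2 * z * genInt (fun φ => (sin φ : ℝ) ^ m * (cos φ : ℝ)) (μ + 1) z +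
      genInt (fun φ => (sin φ : ℝ) ^ m * (cos φ : ℝ) * (cos φ : ℝ)) (μ + 1) z =
      genInt (fun φ => (sin φ : ℝ) ^ m) μ z - genInt (fun φ => (sin φ : ℝ) ^ (m + 2)) (μ + 1) z := by
  have hc := fun (w : ℝ → ℂ) (hw : Continuous w) (ν : ℂ) =>
    (continuous_mul_genPoly_cpow hw ν hz).intervalIntegrable (μ := volume) 0 π
  have i1 := hc (fun φ => (sin φ : ℝ) ^ m) (by fun_prop) (-(μ + 1))
  have i2 := hc (fun φ => (sin φ : ℝ) ^ m * (cos φ : ℝ)) (by fun_prop) (-(μ + 1))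
  have i3 := hc (fun φ => (sin φ : ℝ) ^ m * (cos φ : ℝ) * (cos φ : ℝ)) (by fun_prop) (-(μ + 1))
  have i4 := hc (fun φ => (sin φ : ℝ) ^ m) (by fun_prop) (-μ)
  have i5 := hc (fun φ => (sin φ : ℝ) ^ (m + 2)) (by fun_prop) (-(μ + 1))
  unfold genInt
  rw [← intervalIntegral.integral_const_mul, ← intervalIntegral.integral_const_mul,
    ← intervalIntegral.integral_sub (i1.const_mul _) (i2.const_mul _),
    ← intervalIntegral.integral_add ((i1.const_mul _).sub (i2.const_mul _)) i3,
    ← intervalIntegral.integral_sub i4 i5]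
  congr 1
  ext φ
  have hne : genPoly z φ ≠ 0 := Complex.slitPlane_ne_zero (genPoly_mem_slitPlane hz φ)
  have e : genPoly z φ ^ (-μ) = genPoly z φ * genPoly z φ ^ (-(μ + 1)) := by
    rw [show -μ = 1 + -(μ + 1) by ring, Complex.cpow_add _ _ hne, Complex.cpow_one]
  have hs : ((sin φ : ℝ) : ℂ) ^ 2 = 1 - ((cos φ : ℝ) : ℂ) ^ 2 := by
    rw [← Complex.ofReal_pow, sin_sq]; push_cast; ring
  rw [e, pow_add, hs]
  simp only [genPoly]
  ring

/-- The differential recurrence satisfied by `genInt`. -/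
lemma genInt_ode (m : ℕ) (μ : ℂ) {z : ℂ} (hz : z ∈ Metric.ball (0 : ℂ) 1) :
    z * deriv (deriv (genInt (fun φ => (sin φ : ℝ) ^ m) μ)) z +
      (m + 1) * deriv (genInt (fun φ => (sin φ : ℝ) ^ m) μ) z =
      2 * μ * (2 * μ - m) * (z * genInt (fun φ => (sin φ : ℝ) ^ m) (μ + 1) z) := by
  have hw : Continuous fun φ : ℝ => ((sin φ : ℝ) : ℂ) ^ m := by fun_prop
  have hwc : Continuous fun φ : ℝ => ((sin φ : ℝ) : ℂ) ^ m * ((cos φ : ℝ) : ℂ) := by fun_prop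
  have h1 : deriv (genInt (fun φ => (sin φ : ℝ) ^ m) μ) =ᶠ[𝓝 z] fun z =>
      -2 * μ * (z * genInt (fun φ => (sin φ : ℝ) ^ m) (μ + 1) z -
        genInt (fun φ => (sin φ : ℝ) ^ m * (cos φ : ℝ)) (μ + 1) z) := by
    filter_upwards [Metric.isOpen_ball.mem_nhds hz] with y hy
    exact (hasDerivAt_genInt hw μ hy).deriv
  have h2 := ((((hasDerivAt_id z).mul (hasDerivAt_genInt hw (μ + 1) hz)).sub
    (hasDerivAt_genInt hwc (μ + 1) hz)).const_mul (-2 * μ)).deriv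
  have h3 : deriv (deriv (genInt (fun φ => (sin φ : ℝ) ^ m) μ)) z = _ := h1.deriv_eq.trans h2
  rw [h3, h1.eq_of_nhds]
  have hA := genInt_quadratic m (μ + 1) hz
  have hB := genInt_sin_pow_mul_cos m (μ + 1) hz
  simp only [id]
  -- The second derivative brings in the quadratic combination at exponent μ + 2. Reducing it leaves
  -- a sin^(m+2) integral, which cancels against the cosine term of the first derivative by
  -- integration by parts.
  linear_combination (4 * μ * (μ + 1) * z) * hA + (2 * μ) * hB

lemma differentiableOn_genInt {w : ℝ → ℂ} (hw : Continuous w) (μ : ℂ) :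
    DifferentiableOn ℂ (genInt w μ) (Metric.ball 0 1) := fun _ hz =>
  (hasDerivAt_genInt hw μ hz).differentiableAt.differentiableWithinAt

lemma iteratedDeriv_id_mul {f : ℂ → ℂ} {k : ℕ} (hf : ContDiffAt ℂ k f 0) :
    iteratedDeriv k (fun z => z * f z) 0 = k * iteratedDeriv (k - 1) f 0 := by
  have h := iteratedDeriv_mul (f := fun z : ℂ => z) (g := f) (x := 0) (n := k) contDiffAt_id hf
  have h' : ∀ i, iteratedDeriv i (fun z : ℂ => z) 0 = if i = 1 then 1 else 0 := by
    intro i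
    rcases i with _ | _ | i
    · simp
    · simp
    · rw [iteratedDeriv_succ', iteratedDeriv_succ']
      simp
  change iteratedDeriv k ((fun z : ℂ => z) * f) 0 = _
  rw [h]
  simp only [h']
  simp only [mul_ite, mul_one, mul_zero, ite_mul, zero_mul, Finset.sum_ite_eq', Finset.mem_range]
  rcases k with _ | k
  · simp
  · simp

/-- Take k derivatives of the differential recurrence at 0. For k = 0 the truncated index k - 1 is
harmless because its term carries the factor k. -/
lemma genInt_coeff_recurrence (m : ℕ) (μ : ℂ) (k : ℕ) :
    (k + m + 1) * iteratedDeriv (k + 1) (genInt (fun φ => (sin φ : ℝ) ^ m) μ) 0 =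
      2 * μ * (2 * μ - m) * (k * iteratedDeriv (k - 1)
        (genInt (fun φ => (sin φ : ℝ) ^ m) (μ + 1)) 0) := by
  have hw : Continuous fun φ : ℝ => ((sin φ : ℝ) : ℂ) ^ m := by fun_prop
  have h0 : (0 : ℂ) ∈ Metric.ball (0 : ℂ) 1 := by simp
  set M := genInt (fun φ => (sin φ : ℝ) ^ m) μ
  set N := genInt (fun φ => (sin φ : ℝ) ^ m) (μ + 1)
  have aM : AnalyticAt ℂ M 0 := (differentiableOn_genInt hw μ).analyticAt
    (Metric.isOpen_ball.mem_nhds h0)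
  have aN : AnalyticAt ℂ N 0 := (differentiableOn_genInt hw (μ + 1)).analyticAt
    (Metric.isOpen_ball.mem_nhds h0)
  have heq : (fun z => z * deriv (deriv M) z + (m + 1) * deriv M z) =ᶠ[𝓝 0]
      fun z => 2 * μ * (2 * μ - m) * (z * N z) := by
    filter_upwards [Metric.isOpen_ball.mem_nhds h0] with y hy
    exact genInt_ode m μ hy
  have h1 := heq.iteratedDeriv_eq k
  have c1 : ContDiffAt ℂ k (fun z => z * deriv (deriv M) z) 0 :=
    contDiffAt_id.mul aM.deriv.deriv.contDiffAt
  have c2 : ContDiffAt ℂ k (fun z => (m + 1) * deriv M z) 0 :=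
    contDiffAt_const.mul aM.deriv.contDiffAt
  rw [iteratedDeriv_fun_add c1 c2, iteratedDeriv_id_mul aM.deriv.deriv.contDiffAt,
    iteratedDeriv_const_mul_field, iteratedDeriv_const_mul_field,
    iteratedDeriv_id_mul aN.contDiffAt, ← iteratedDeriv_succ'] at h1
  rw [← h1]
  rcases k with _ | k
  · simp
  · rw [Nat.add_sub_cancel, ← iteratedDeriv_succ']
    push_cast
    ring

lemma genInt_zero (w : ℝ → ℂ) (μ : ℂ) : genInt w μ 0 = ∫ φ in (0 : ℝ)..π, w φ := by
  simp [genInt, genPoly]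

/-- The case k = 0 of the recurrence kills the first derivative, and each further step lowers the
order by two while raising μ, so the induction runs over all μ. -/
lemma genInt_coeff_odd (m : ℕ) (k : ℕ) (μ : ℂ) :
    iteratedDeriv (2 * k + 1) (genInt (fun φ => (sin φ : ℝ) ^ m) μ) 0 = 0 := by
  induction k generalizing μ with
  | zero =>
    have h := genInt_coeff_recurrence m μ 0
    simp only [CharP.cast_eq_zero, zero_mul, mul_zero, zero_add] at h
    exact (mul_eq_zero.1 h).resolve_left (by exact_mod_cast Nat.succ_ne_zero m)
  | succ k ih =>
    have h := genInt_coeff_recurrence m μ (2 * k + 2)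
    rw [show 2 * k + 2 - 1 = 2 * k + 1 by omega, ih, mul_zero, mul_zero] at h
    exact (mul_eq_zero.1 h).resolve_left (by exact_mod_cast Nat.succ_ne_zero (2 * k + 2 + m))

lemma ascPochhammer_succ_eval_left (k : ℕ) (a : ℝ) :
    (ascPochhammer ℝ (k + 1)).eval a = a * (ascPochhammer ℝ k).eval (a + 1) := by
  rw [ascPochhammer_succ_left]; simp

/-- The shift μ ↦ μ + 1 is (a)_(k+1) = a (a+1)_k for both upper parameters. The lower parameter is
unshifted and gains its new factor at the other end. -/
lemma genInt_coeff_even (m : ℕ) (k : ℕ) (μ : ℝ) :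
    iteratedDeriv (2 * k) (genInt (fun φ => (sin φ : ℝ) ^ m) μ) 0 =
      (((2 * k).factorial * ((∫ φ in (0 : ℝ)..π, sin φ ^ m) *
        ordinaryHypergeometricCoefficient μ (μ - m / 2) (m / 2 + 1) k) : ℝ) : ℂ) := by
  induction k generalizing μ with
  | zero =>
    simp only [mul_zero, iteratedDeriv_zero, genInt_zero]
    rw [Nat.factorial_zero]
    simp only [ordinaryHypergeometricCoefficient, Nat.factorial_zero, Nat.cast_one, inv_one,
      ascPochhammer_zero, Polynomial.eval_one, mul_one, one_mul]
    rw [← intervalIntegral.integral_ofReal]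
    simp
  | succ k ih =>
    have h := genInt_coeff_recurrence m μ (2 * k + 1)
    have ih' := ih (μ + 1)
    rw [Nat.add_sub_cancel, show (μ : ℂ) + 1 = ((μ + 1 : ℝ) : ℂ) by push_cast; rfl, ih'] at h
    have hne : ((2 * k + 1 : ℕ) : ℂ) + m + 1 ≠ 0 := by
      exact_mod_cast Nat.succ_ne_zero (2 * k + 1 + m)
    rw [show 2 * (k + 1) = 2 * k + 1 + 1 by ring]
    apply mul_left_cancel₀ hne
    rw [h]
    have hp : (ascPochhammer ℝ k).eval ((m : ℝ) / 2 + 1) ≠ 0 :=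
      (ascPochhammer_pos k _ (by positivity)).ne'
    have hp' : ((m : ℝ) / 2 + 1 + k) ≠ 0 := by positivity
    have hf : ((k.factorial : ℕ) : ℝ) ≠ 0 := by positivity
    have hk : ((k : ℝ) + 1) ≠ 0 := by positivity
    norm_cast
    push_cast [Nat.factorial_succ, ordinaryHypergeometricCoefficient]
    rw [ascPochhammer_succ_eval_left, ascPochhammer_succ_eval_left, ascPochhammer_succ_eval,
      show μ - m / 2 + 1 = μ + 1 - m / 2 by ring]
    field_simp
    ring

lemma genInt_hasSum (m : ℕ) (μ : ℝ) {z : ℂ} (hz : z ∈ Metric.ball (0 : ℂ) 1) :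
    HasSum (fun k : ℕ => (((∫ φ in (0 : ℝ)..π, sin φ ^ m) *
        ordinaryHypergeometricCoefficient μ (μ - m / 2) (m / 2 + 1) k : ℝ) : ℂ) * (z ^ 2) ^ k)
      (genInt (fun φ => (sin φ : ℝ) ^ m) μ z) := by
  have hw : Continuous fun φ : ℝ => ((sin φ : ℝ) : ℂ) ^ m := by fun_prop
  have h := Complex.hasSum_taylorSeries_on_ball (differentiableOn_genInt hw μ) hz
  rw [← (mul_right_injective₀ (two_ne_zero (α := ℕ))).hasSum_iff] at h
  · refine h.congr_fun ?_
    intro k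
    simp only [Function.comp, genInt_coeff_even, sub_zero, smul_eq_mul]
    have : (((2 * k).factorial : ℕ) : ℂ) ≠ 0 := by exact_mod_cast Nat.factorial_ne_zero _
    push_cast
    rw [← pow_mul z 2 k]
    field_simp
  · intro k hk
    rcases Nat.even_or_odd' k with ⟨j, rfl | rfl⟩
    · exact absurd ⟨j, rfl⟩ hk
    · rw [genInt_coeff_odd]; simp

lemma integral_sin_pow_mul_rpow_eq (m : ℕ) (μ : ℝ) {z : ℝ} (hz : |z| < 1) :
    ∫ φ in (0 : ℝ)..π, sin φ ^ m * (1 + z ^ 2 - 2 * z * cos φ) ^ (-μ) =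
      (∫ φ in (0 : ℝ)..π, sin φ ^ m) *
        ordinaryHypergeometric μ (μ - m / 2) (m / 2 + 1) (z ^ 2) := by
  have hz' : (z : ℂ) ∈ Metric.ball (0 : ℂ) 1 := by simpa using hz
  have h := genInt_hasSum m μ hz'
  have e : genInt (fun φ => (sin φ : ℝ) ^ m) μ z =
      ((∫ φ in (0 : ℝ)..π, sin φ ^ m * (1 + z ^ 2 - 2 * z * cos φ) ^ (-μ) : ℝ) : ℂ) := by
    rw [← intervalIntegral.integral_ofReal]
    unfold genInt
    congr 1
    ext φ
    have hpos : 0 ≤ 1 + z ^ 2 - 2 * z * cos φ := by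
      nlinarith [sin_sq_add_cos_sq φ, sq_nonneg (z - cos φ), sq_nonneg (sin φ)]
    rw [Complex.ofReal_mul, Complex.ofReal_cpow hpos]
    simp [genPoly]
  rw [e] at h
  have h' := Complex.hasSum_ofReal.1 (h.congr_fun (g := fun k => (((∫ φ in (0 : ℝ)..π, sin φ ^ m) *
        ordinaryHypergeometricCoefficient μ (μ - m / 2) (m / 2 + 1) k * (z ^ 2) ^ k : ℝ) : ℂ))
        (by intro k; push_cast; rfl))
  rw [ordinaryHypergeometric_eq_tsum, ← h'.tsum_eq, ← tsum_mul_left]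
  congr 1
  ext k
  rw [smul_eq_mul, mul_assoc]

/-! ### Gamma constants and the hypergeometric form of the kernel -/

lemma integral_sin_pow_eq_Gamma (m : ℕ) :
    ∫ φ in (0 : ℝ)..π, sin φ ^ m = √π * Gamma (((m : ℝ) + 1) / 2) / Gamma ((m : ℝ) / 2 + 1) := by
  induction m using Nat.twoStepInduction with
  | zero =>
    have h := Gamma_one_half_eq
    rw [one_div] at h
    simp [h, mul_self_sqrt pi_pos.le]
  | one =>
    have h1 : Gamma ((1 : ℝ) / 2 + 1) = 1 / 2 * √π := by
      rw [Gamma_add_one (by norm_num), Gamma_one_half_eq]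
    have h2 : √π ≠ 0 := by positivity
    norm_num [integral_sin]
    rw [show (3 / 2 : ℝ) = 1 / 2 + 1 by norm_num, h1]
    field_simp
  | more m ih _ =>
    have h1 : Gamma ((((m + 2 : ℕ) : ℝ) + 1) / 2) =
        (((m : ℝ) + 1) / 2) * Gamma (((m : ℝ) + 1) / 2) := by
      rw [← Gamma_add_one (by positivity)]; congr 1; push_cast; ring
    have h2 : Gamma (((m + 2 : ℕ) : ℝ) / 2 + 1) = ((m : ℝ) / 2 + 1) * Gamma ((m : ℝ) / 2 + 1) := by
      rw [← Gamma_add_one (by positivity)]; congr 1; push_cast; ring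
    have h3 : Gamma ((m : ℝ) / 2 + 1) ≠ 0 := (Gamma_pos_of_pos (by positivity)).ne'
    rw [integral_sin_pow, ih, h1, h2]
    simp only [sin_zero, sin_pi, zero_pow (Nat.succ_ne_zero m)]
    field_simp
    ring

/-- This identifies 2πα_n as the area of the unit sphere of ℝ^(n-1), the sphere of directions
orthogonal to the axis. -/
lemma two_pi_alpha (m : ℕ) :
    2 * π * alpha (m + 2) = 2 * π ^ (((m : ℝ) + 1) / 2) / Gamma (((m : ℝ) + 1) / 2) := by
  unfold alpha
  have : π ^ (((m : ℝ) + 1) / 2) = π * π ^ ((((m + 2 : ℕ) : ℝ) - 3) / 2) := by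
    rw [← rpow_one_add' pi_pos.le (by push_cast; ring_nf; positivity)]
    congr 1; push_cast; ring
  rw [this]
  push_cast
  ring_nf

lemma two_pi_alpha_mul_integral {n : ℕ} (hn : 2 ≤ n) :
    2 * π * alpha n * ∫ φ in (0 : ℝ)..π, sin φ ^ (n - 2) =
      2 * π ^ ((n : ℝ) / 2) / Gamma ((n : ℝ) / 2) := by
  obtain ⟨m, rfl⟩ : ∃ m, n = m + 2 := ⟨n - 2, by omega⟩
  rw [two_pi_alpha, Nat.add_sub_cancel, integral_sin_pow_eq_Gamma]
  have h3 : Gamma (((m : ℝ) + 1) / 2) ≠ 0 := (Gamma_pos_of_pos (by positivity)).ne'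
  have : π ^ (((m + 2 : ℕ) : ℝ) / 2) = π ^ (((m : ℝ) + 1) / 2) * √π := by
    rw [sqrt_eq_rpow, ← rpow_add pi_pos]
    congr 1; push_cast; ring
  rw [this, show ((m + 2 : ℕ) : ℝ) / 2 = (m : ℝ) / 2 + 1 by push_cast; ring]
  field_simp

/-- Pulling τ² out of Q leaves the generating polynomial at z = 1/τ, to which the series formula
applies. -/
lemma kernel_eq_hypergeometric {n : ℕ} (hn : 2 ≤ n) (s : ℝ) {τ : ℝ} (hτ : 1 < τ) :
    τ * (τ ^ 2 - 1) ^ (-1 - 2 * s) * H n s τ =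
      2 * π ^ ((n : ℝ) / 2) / Gamma ((n : ℝ) / 2) * τ ^ (-1 - 2 * s) *
        ordinaryHypergeometric (((n : ℝ) + 2 * s) / 2) (1 + s) ((n : ℝ) / 2) (τ ^ (-2 : ℝ)) := by
  have h0 : 0 < τ := by linarith
  have hz : |τ⁻¹| < 1 := by
    rw [abs_of_pos (by positivity)]; exact inv_lt_one_of_one_lt₀ hτ
  have key := integral_sin_pow_mul_rpow_eq (n - 2) (((n : ℝ) + 2 * s) / 2) hz
  rw [Nat.cast_sub hn] at key
  rw [kernel_eq hτ hn, ← two_pi_alpha_mul_integral hn]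
  have e : ∀ φ, sin φ ^ (n - 2) * distSq τ φ ^ (-(((n : ℝ) + 2 * s) / 2)) =
      τ ^ (-((n : ℝ) + 2 * s)) *
      (sin φ ^ (n - 2) * (1 + τ⁻¹ ^ 2 - 2 * τ⁻¹ * cos φ) ^ (-(((n : ℝ) + 2 * s) / 2))) := by
    intro φ
    have hd : distSq τ φ = τ ^ 2 * (1 + τ⁻¹ ^ 2 - 2 * τ⁻¹ * cos φ) := by
      unfold distSq; field_simp; ring
    have hpos : 0 ≤ 1 + τ⁻¹ ^ 2 - 2 * τ⁻¹ * cos φ := by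
      nlinarith [sin_sq_add_cos_sq φ, sq_nonneg (τ⁻¹ - cos φ), sq_nonneg (sin φ)]
    rw [hd, mul_rpow (by positivity) hpos, ← rpow_natCast τ 2, ← rpow_mul h0.le,
      show ((2 : ℕ) : ℝ) * -(((n : ℝ) + 2 * s) / 2) = -((n : ℝ) + 2 * s) by push_cast; ring]
    ring
  simp_rw [e]
  rw [intervalIntegral.integral_const_mul, key]
  have e2 : τ⁻¹ ^ 2 = τ ^ (-2 : ℝ) := by
    rw [rpow_neg h0.le, inv_pow]; norm_cast
  have e3 : τ ^ (n - 1) * τ ^ (-((n : ℝ) + 2 * s)) = τ ^ (-1 - 2 * s) := by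
    rw [← rpow_natCast, ← rpow_add h0, Nat.cast_sub (by omega)]
    congr 1; push_cast; ring
  rw [e2, ← e3]
  have e4 : ((n : ℝ) + 2 * s) / 2 - ((n : ℝ) - (2 : ℕ)) / 2 = 1 + s := by push_cast; ring
  have e5 : ((n : ℝ) - (2 : ℕ)) / 2 + 1 = (n : ℝ) / 2 := by push_cast; ring
  rw [e4, e5]
  ring

/-! ### Polar coordinates around an axis -/

lemma lintegral_fun_norm_euclidean (m : ℕ) {f : ℝ → ℝ≥0∞} (hf : Measurable f) :
    ∫⁻ y : EuclideanSpace ℝ (Fin (m + 1)), f ‖y‖ =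
      ∫⁻ ρ in Ioi (0 : ℝ), ENNReal.ofReal (2 * π * alpha (m + 2) * ρ ^ m) * f ρ := by
  set E := EuclideanSpace ℝ (Fin (m + 1))
  have hdim : Module.finrank ℝ E = m + 1 := by simp [E]
  have hpow : Measurable fun r : Ioi (0 : ℝ) => ENNReal.ofReal ((r : ℝ) ^ m) := by fun_prop
  have hsph : (volume : Measure E).toSphere univ = ENNReal.ofReal (2 * π * alpha (m + 2)) := by
    rw [Measure.toSphere_apply_univ, hdim, EuclideanSpace.volume_ball, Fintype.card_fin,
      ENNReal.ofReal_one, one_pow, one_mul, ← ENNReal.ofReal_natCast,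
      ← ENNReal.ofReal_mul (by positivity), two_pi_alpha]
    congr 1
    have h1 : √π ^ (m + 1) = π ^ (((m : ℝ) + 1) / 2) := by
      rw [sqrt_eq_rpow, ← rpow_natCast, ← rpow_mul pi_pos.le]
      congr 1; push_cast; ring
    push_cast
    rw [h1, Gamma_add_one (by positivity)]
    have h3 : Gamma (((m : ℝ) + 1) / 2) ≠ 0 := (Gamma_pos_of_pos (by positivity)).ne'
    field_simp
  calc ∫⁻ y : E, f ‖y‖ = ∫⁻ y : ({(0)}ᶜ : Set E), f ‖y.1‖ ∂((volume : Measure E).comap Subtype.val) := by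
        rw [lintegral_subtype_comap (measurableSet_singleton _).compl fun y => f ‖y‖,
          restrict_compl_singleton]
    _ = ∫⁻ p, f p.2 ∂(volume : Measure E).toSphere.prod (.volumeIoiPow m) := by
        have h := (volume : Measure E).measurePreserving_homeomorphUnitSphereProd.lintegral_comp_emb
          (Homeomorph.measurableEmbedding _) (f ∘ Subtype.val ∘ Prod.snd)
        rw [hdim, Nat.add_sub_cancel] at h
        simpa using h
    _ = (volume : Measure E).toSphere univ * ∫⁻ ρ : Ioi (0 : ℝ), f ρ ∂.volumeIoiPow m := by
        rw [lintegral_prod _ (by fun_prop)]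
        simp [mul_comm]
    _ = _ := by
        rw [hsph, Measure.volumeIoiPow, lintegral_withDensity_eq_lintegral_mul _ hpow (by fun_prop)]
        simp only [Pi.mul_apply]
        rw [lintegral_subtype_comap measurableSet_Ioi fun a => ENNReal.ofReal (a ^ m) * f a,
          ← lintegral_const_mul _ (by fun_prop)]
        refine setLIntegral_congr_fun measurableSet_Ioi fun ρ hρ => ?_
        have ha := (alpha_pos (n := m + 2) (by omega))
        rw [← mul_assoc, ← ENNReal.ofReal_mul (by positivity)]

/-- Cylindrical coordinates around the axis spanned by `x`. -/
lemma exists_cylindrical (m : ℕ) {x : EuclideanSpace ℝ (Fin (m + 2))} (hx : x ≠ 0) :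
    ∃ Φ : EuclideanSpace ℝ (Fin (m + 2)) → ℝ × EuclideanSpace ℝ (Fin (m + 1)),
      MeasurePreserving Φ ∧ ∀ y, ‖y‖ = √((Φ y).1 ^ 2 + ‖(Φ y).2‖ ^ 2) ∧
        ⟪x, y⟫ = ‖x‖ * (Φ y).1 := by
  have hx' : ‖x‖ ≠ 0 := norm_ne_zero_iff.2 hx
  -- Only index 0 is prescribed, so the constant family v merely places x/|x| there.
  obtain ⟨b, hb⟩ := Orthonormal.exists_orthonormalBasis_extension_of_card_eq (𝕜 := ℝ)
    (E := EuclideanSpace ℝ (Fin (m + 2))) (ι := Fin (m + 2)) (by simp)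
    (v := fun _ => ‖x‖⁻¹ • x) (s := {0}) (by
      rw [orthonormal_iff_ite]
      rintro ⟨i, rfl⟩ ⟨j, rfl⟩
      simp only [Set.domRestrict, inner_self_eq_norm_sq_to_K, norm_smul, norm_inv, norm_norm,
        inv_mul_cancel₀ hx']
      simp)
  have hb0 : b 0 = ‖x‖⁻¹ • x := hb 0 rfl
  refine ⟨fun y => Prod.map id (WithLp.toLp 2)
    (MeasurableEquiv.piFinSuccAbove (fun _ => ℝ) 0 (WithLp.ofLp (b.repr y))), ?_, ?_⟩
  · exact ((MeasurePreserving.id volume).prod (PiLp.volume_preserving_toLp (Fin (m + 1)))).comp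
      ((volume_preserving_piFinSuccAbove (fun _ => ℝ) 0).comp
        ((PiLp.volume_preserving_ofLp (Fin (m + 2))).comp b.measurePreserving_repr))
  · intro y
    constructor
    · rw [← b.repr.norm_map y, EuclideanSpace.norm_eq, EuclideanSpace.norm_sq_eq,
        Fin.sum_univ_succ]
      simp [MeasurableEquiv.piFinSuccAbove]
      rfl
    · have : ⟪b 0, y⟫ = b.repr y 0 := (b.repr_apply_apply y 0).symm
      rw [hb0, inner_smul_left] at this
      change ⟪x, y⟫ = ‖x‖ * b.repr y 0
      rw [← this]
      simp [hx']

/-- Integrating out directions orthogonal to x leaves the half-plane (a, b), b > 0, with density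
b^m. Planar polar coordinates turn b^m and the Jacobian ρ into ρ^(m+1) sin^m φ. -/
lemma lintegral_norm_angle (m : ℕ) {x : EuclideanSpace ℝ (Fin (m + 2))} (hx : x ≠ 0)
    {G : ℝ × ℝ → ℝ≥0∞} (hG : Measurable G) :
    ∫⁻ y, G (‖y‖, InnerProductGeometry.angle x y) =
      ∫⁻ p in Ioi (0 : ℝ) ×ˢ Ioo (0 : ℝ) π,
        ENNReal.ofReal (2 * π * alpha (m + 2) * p.1 ^ (m + 1) * sin p.2 ^ m) * G p := by
  have hx' : ‖x‖ ≠ 0 := norm_ne_zero_iff.2 hx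
  have ha := (alpha_pos (n := m + 2) (by omega))
  obtain ⟨Φ, hΦ, hΦ'⟩ := exists_cylindrical m hx
  set G' : ℝ × ℝ → ℝ≥0∞ := fun p =>
    G (√(p.1 ^ 2 + p.2 ^ 2), arccos (p.1 / √(p.1 ^ 2 + p.2 ^ 2))) with hG'
  have hG'm : Measurable G' := by
    refine hG.comp ?_
    refine Measurable.prodMk (by fun_prop) (measurable_arccos.comp (by fun_prop))
  have e1 : ∀ y, G (‖y‖, InnerProductGeometry.angle x y) =
      (fun q : ℝ × EuclideanSpace ℝ (Fin (m + 1)) => G' (q.1, ‖q.2‖)) (Φ y) := by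
    intro y
    obtain ⟨h1, h2⟩ := hΦ' y
    simp only [hG', InnerProductGeometry.angle, h2, ← h1]
    rw [mul_div_mul_left _ _ hx']
  simp_rw [e1]
  refine (hΦ.lintegral_comp (f := fun q : ℝ × EuclideanSpace ℝ (Fin (m + 1)) => G' (q.1, ‖q.2‖))
    (by fun_prop)).trans ?_
  rw [Measure.volume_eq_prod, lintegral_prod _ (by fun_prop)]
  have e2 : ∀ a : ℝ, ∫⁻ y : EuclideanSpace ℝ (Fin (m + 1)), G' (a, ‖y‖) =
      ∫⁻ b : ℝ, (Ioi (0 : ℝ)).indicator (fun b => ENNReal.ofReal (2 * π * alpha (m + 2) * b ^ m) *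
        G' (a, b)) b := by
    intro a
    rw [lintegral_fun_norm_euclidean m (f := fun b => G' (a, b)) (by fun_prop),
      lintegral_indicator measurableSet_Ioi]
  simp_rw [e2]
  set K : ℝ × ℝ → ℝ≥0∞ := (univ ×ˢ Ioi (0 : ℝ)).indicator
    fun p => ENNReal.ofReal (2 * π * alpha (m + 2) * p.2 ^ m) * G' p with hK
  have hKm : Measurable K :=
    Measurable.indicator (by fun_prop) (MeasurableSet.univ.prod measurableSet_Ioi)
  have e3 : ∀ a b : ℝ, (Ioi (0 : ℝ)).indicator (fun b => ENNReal.ofReal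
      (2 * π * alpha (m + 2) * b ^ m) * G' (a, b)) b = K (a, b) := by
    intro a b
    by_cases hb : 0 < b
    · rw [hK, indicator_of_mem (by exact hb), indicator_of_mem (by simpa using hb)]
    · rw [hK, indicator_of_notMem (by exact hb), indicator_of_notMem (by simpa using hb)]
  simp_rw [e3]
  rw [← lintegral_prod _ hKm.aemeasurable, ← Measure.volume_eq_prod,
    ← lintegral_comp_polarCoord_symm,
    ← lintegral_indicator polarCoord.open_target.measurableSet,
    ← lintegral_indicator (measurableSet_Ioi.prod measurableSet_Ioo)]
  refine lintegral_congr fun p => ?_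
  obtain ⟨ρ, φ⟩ := p
  by_cases hρ : 0 < ρ
  swap
  · rw [indicator_of_notMem (by simp [polarCoord_target, hρ]), indicator_of_notMem (by simp [hρ])]
  by_cases hφ : φ ∈ Ioo 0 π
  · have hs := sin_pos_of_mem_Ioo hφ
    rw [indicator_of_mem (show (ρ, φ) ∈ polarCoord.target from
        ⟨hρ, by linarith [hφ.1, pi_pos], hφ.2⟩), indicator_of_mem (show (ρ, φ) ∈ Ioi (0 : ℝ) ×ˢ Ioo 0 π from ⟨hρ, hφ⟩),
      polarCoord_symm_apply, hK, indicator_of_mem (by simp; positivity)]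
    have hn : √((ρ * cos φ) ^ 2 + (ρ * sin φ) ^ 2) = ρ := by
      rw [show (ρ * cos φ) ^ 2 + (ρ * sin φ) ^ 2 = ρ ^ 2 by
        linear_combination ρ ^ 2 * sin_sq_add_cos_sq φ, sqrt_sq hρ.le]
    simp only [hG', hn]
    rw [mul_div_cancel_left₀ _ hρ.ne', arccos_cos hφ.1.le hφ.2.le, smul_eq_mul, ← mul_assoc,
      ← ENNReal.ofReal_mul hρ.le]
    congr 2
    ring
  -- Angles in (-π, 0] have sin φ ≤ 0 and so fall outside the half-plane.
  · rw [indicator_of_notMem (s := Ioi (0 : ℝ) ×ˢ Ioo 0 π) (by simpa [hρ] using hφ)]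
    by_cases hφ' : (ρ, φ) ∈ polarCoord.target
    · rw [indicator_of_mem hφ', polarCoord_symm_apply, hK, indicator_of_notMem, smul_zero]
      have h2 : φ ∈ Ioo (-π) π := hφ'.2
      have : sin φ ≤ 0 := sin_nonpos_of_nonpos_of_neg_pi_le
        (by by_contra! h; exact hφ ⟨h, h2.2⟩) h2.1.le
      simp only [mem_prod, mem_univ, mem_Ioi, true_and, not_lt]
      nlinarith
    · rw [indicator_of_notMem hφ']

/-- The inversion invariant measure `dτ / τ` on `(0, ∞)`. -/
noncomputable def logMeasure : Measure ℝ :=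
  (volume.restrict (Ioi 0)).withDensity fun τ => ENNReal.ofReal τ⁻¹

/-- The distribution of the polar angle on the unit sphere of `ℝⁿ`. -/
noncomputable def angleMeasure (n : ℕ) : Measure ℝ :=
  (volume.restrict (Ioo 0 π)).withDensity
    fun φ => ENNReal.ofReal (2 * π * alpha n * sin φ ^ (n - 2))

/-- The polar coordinates `(‖y‖ / ‖x‖, angle x y)`. -/
noncomputable def polar {n : ℕ} (x y : EuclideanSpace ℝ (Fin n)) : ℝ × ℝ :=
  (‖y‖ / ‖x‖, InnerProductGeometry.angle x y)

lemma measurable_polar {n : ℕ} (x : EuclideanSpace ℝ (Fin n)) : Measurable (polar x) := by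
  unfold polar InnerProductGeometry.angle
  exact Measurable.prodMk (by fun_prop) (measurable_arccos.comp (by fun_prop))

instance : SFinite logMeasure := by unfold logMeasure; infer_instance

instance (n : ℕ) : IsFiniteMeasure (angleMeasure n) := by
  unfold angleMeasure
  refine isFiniteMeasure_withDensity_ofReal ?_
  have hc : Continuous fun φ => 2 * π * alpha n * sin φ ^ (n - 2) := by fun_prop
  exact ((hc.integrableOn_Icc (a := 0) (b := π)).mono_set Ioo_subset_Icc_self).2

lemma logMeasure_ae_pos : ∀ᵐ τ ∂logMeasure, 0 < τ := by
  have h : ∀ᵐ τ ∂(volume.restrict (Ioi (0 : ℝ))), 0 < τ := ae_restrict_mem measurableSet_Ioi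
  exact (withDensity_absolutelyContinuous _ _).ae_le h

lemma prod_ae_pos (n : ℕ) : ∀ᵐ p ∂(logMeasure.prod (angleMeasure n)), 0 < p.1 :=
  Measure.quasiMeasurePreserving_fst.ae logMeasure_ae_pos

lemma lintegral_polar_aux {n : ℕ} (hn : 2 ≤ n) {x : EuclideanSpace ℝ (Fin n)} (hx : x ≠ 0)
    {G : ℝ × ℝ → ℝ≥0∞} (hG : Measurable G) :
    ∫⁻ y, G (‖y‖, InnerProductGeometry.angle x y) =
      ∫⁻ p, ENNReal.ofReal (p.1 ^ n) * G p ∂(logMeasure.prod (angleMeasure n)) := by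
  obtain ⟨m, rfl⟩ : ∃ m, n = m + 2 := ⟨n - 2, by omega⟩
  have ha := alpha_pos hn
  rw [lintegral_norm_angle m hx hG, logMeasure, angleMeasure,
    prod_withDensity (by fun_prop) (by fun_prop), Measure.prod_restrict, ← Measure.volume_eq_prod,
    lintegral_withDensity_eq_lintegral_mul _ (by fun_prop) (by fun_prop)]
  refine setLIntegral_congr_fun (measurableSet_Ioi.prod measurableSet_Ioo) fun p hp => ?_
  have h1 : 0 < p.1 := hp.1
  have h2 := sin_pos_of_mem_Ioo hp.2
  simp only [Pi.mul_apply, Nat.add_sub_cancel]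
  rw [← mul_assoc, ← ENNReal.ofReal_mul (by positivity), ← ENNReal.ofReal_mul (by positivity)]
  congr 2
  field_simp
  ring

lemma lintegral_polar {n : ℕ} (hn : 2 ≤ n) {x : EuclideanSpace ℝ (Fin n)} (hx : x ≠ 0)
    {G : ℝ × ℝ → ℝ≥0∞} (hG : Measurable G) :
    ∫⁻ y, G (polar x y) =
      ∫⁻ p, ENNReal.ofReal ((‖x‖ * p.1) ^ n) * G p ∂(logMeasure.prod (angleMeasure n)) := by
  have hr : 0 < ‖x‖ := norm_pos_iff.2 hx
  have hmap := Measure.map_addHaar_smul (volume : Measure (EuclideanSpace ℝ (Fin n)))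
    (r := ‖x‖⁻¹) (by positivity)
  have h1 := lintegral_polar_aux hn hx hG
  have e : ∀ y, G (polar x y) =
      (fun z => G (‖z‖, InnerProductGeometry.angle x z)) (‖x‖⁻¹ • y) := by
    intro y
    simp only [polar]
    rw [InnerProductGeometry.angle_smul_right_of_pos _ _ (by positivity), norm_smul, norm_inv,
      norm_norm, div_eq_inv_mul]
  have hm : Measurable fun z => G (‖z‖, InnerProductGeometry.angle x z) := by
    refine hG.comp (Measurable.prodMk (by fun_prop) ?_)
    unfold InnerProductGeometry.angle
    exact measurable_arccos.comp (by fun_prop)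
  simp_rw [e]
  rw [← lintegral_map hm (by fun_prop), hmap, lintegral_smul_measure, h1, smul_eq_mul,
    ← lintegral_const_mul _ (by fun_prop)]
  refine lintegral_congr_ae ?_
  filter_upwards [prod_ae_pos n] with p hp
  rw [← mul_assoc, ← ENNReal.ofReal_mul (by positivity), mul_pow]
  congr 3
  rw [inv_pow, inv_inv, abs_of_pos (by positivity)]
  simp

lemma map_polar {n : ℕ} (hn : 2 ≤ n) {x : EuclideanSpace ℝ (Fin n)} (hx : x ≠ 0) :
    Measure.map (polar x) volume = (logMeasure.prod (angleMeasure n)).withDensity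
      fun p => ENNReal.ofReal ((‖x‖ * p.1) ^ n) := by
  refine Measure.ext_of_lintegral _ fun G hG => ?_
  rw [lintegral_map hG (measurable_polar x), lintegral_polar hn hx hG,
    lintegral_withDensity_eq_lintegral_mul _ (by fun_prop) hG]
  rfl

lemma ae_toReal_smul_eq (n : ℕ) {r : ℝ} (hr : 0 < r) (g : ℝ × ℝ → ℝ) :
    (fun p : ℝ × ℝ => (ENNReal.ofReal ((r * p.1) ^ n)).toReal • g p)
      =ᵐ[logMeasure.prod (angleMeasure n)] fun p => r ^ n * (p.1 ^ n * g p) := by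
  filter_upwards [prod_ae_pos n] with p hp
  rw [ENNReal.toReal_ofReal (by positivity), smul_eq_mul, mul_pow, mul_assoc]

lemma integrable_polar {n : ℕ} (hn : 2 ≤ n) {x : EuclideanSpace ℝ (Fin n)} (hx : x ≠ 0)
    {g : ℝ × ℝ → ℝ} (hg : Measurable g) :
    Integrable (fun y => g (polar x y)) ↔
      Integrable (fun p => p.1 ^ n * g p) (logMeasure.prod (angleMeasure n)) := by
  have hr : 0 < ‖x‖ := norm_pos_iff.2 hx
  have h := integrable_map_measure (μ := (volume : Measure (EuclideanSpace ℝ (Fin n))))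
    hg.aestronglyMeasurable (measurable_polar x).aemeasurable
  change _ ↔ Integrable (fun y => g (polar x y)) _ at h
  rw [← h, map_polar hn hx, integrable_withDensity_iff_integrable_smul' (by fun_prop)
    (Eventually.of_forall fun _ => ENNReal.ofReal_lt_top), integrable_congr
    (ae_toReal_smul_eq n hr g), integrable_const_mul_iff (IsUnit.mk0 _ (by positivity))]

lemma integral_polar {n : ℕ} (hn : 2 ≤ n) {x : EuclideanSpace ℝ (Fin n)} (hx : x ≠ 0)
    {g : ℝ × ℝ → ℝ} (hg : Measurable g) :
    ∫ y, g (polar x y) =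
      ‖x‖ ^ n * ∫ p, p.1 ^ n * g p ∂(logMeasure.prod (angleMeasure n)) := by
  have hr : 0 < ‖x‖ := norm_pos_iff.2 hx
  rw [← integral_map (measurable_polar x).aemeasurable hg.aestronglyMeasurable, map_polar hn hx,
    integral_withDensity_eq_integral_toReal_smul (by fun_prop)
    (Eventually.of_forall fun _ => ENNReal.ofReal_lt_top), integral_congr_ae
    (ae_toReal_smul_eq n hr g), integral_const_mul]

lemma norm_sub_sq_eq_distSq {n : ℕ} {x : EuclideanSpace ℝ (Fin n)} (hx : x ≠ 0)
    (y : EuclideanSpace ℝ (Fin n)) :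
    ‖x - y‖ ^ 2 = ‖x‖ ^ 2 * distSq (polar x y).1 (polar x y).2 := by
  have hr : 0 < ‖x‖ := norm_pos_iff.2 hx
  have h := InnerProductGeometry.cos_angle_mul_norm_mul_norm x y
  rw [norm_sub_sq_real, ← h]
  simp only [polar, distSq]
  field_simp
  ring

/-! ### The inversion τ ↦ 1/τ -/

lemma measurePreserving_inv_logMeasure :
    MeasurePreserving (fun τ : ℝ => τ⁻¹) logMeasure logMeasure := by
  refine ⟨by fun_prop, Measure.ext_of_lintegral _ fun f hf => ?_⟩
  rw [lintegral_map hf (by fun_prop), logMeasure,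
    lintegral_withDensity_eq_lintegral_mul _ (by fun_prop) (by fun_prop),
    lintegral_withDensity_eq_lintegral_mul _ (by fun_prop) hf]
  have himg : (fun τ : ℝ => τ⁻¹) '' Ioi 0 = Ioi 0 := by
    ext τ
    constructor
    · rintro ⟨t, ht, rfl⟩
      exact mem_Ioi.2 (inv_pos.2 (mem_Ioi.1 ht))
    · intro h
      exact ⟨τ⁻¹, mem_Ioi.2 (inv_pos.2 (mem_Ioi.1 h)), inv_inv τ⟩
  have h := lintegral_image_eq_lintegral_abs_deriv_mul (s := Ioi (0 : ℝ)) (f := fun τ => τ⁻¹)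
    (f' := fun τ => -(τ ^ 2)⁻¹) measurableSet_Ioi
    (fun τ hτ => (hasDerivAt_inv (ne_of_gt hτ)).hasDerivWithinAt)
    (inv_injective.injOn) (fun τ => ENNReal.ofReal τ⁻¹ * f τ)
  rw [himg] at h
  simp only [Pi.mul_apply]
  rw [h]
  refine setLIntegral_congr_fun measurableSet_Ioi fun τ hτ => ?_
  have hτ' : (0 : ℝ) < τ := hτ
  rw [← mul_assoc, ← ENNReal.ofReal_mul (by positivity)]
  congr 2
  rw [abs_neg, abs_of_pos (by positivity)]
  field_simp

lemma measurePreserving_inv_prod (n : ℕ) :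
    MeasurePreserving (fun p : ℝ × ℝ => (p.1⁻¹, p.2)) (logMeasure.prod (angleMeasure n))
      (logMeasure.prod (angleMeasure n)) :=
  measurePreserving_inv_logMeasure.prod (MeasurePreserving.id _)

lemma measurableEmbedding_inv_prod :
    MeasurableEmbedding (fun p : ℝ × ℝ => (p.1⁻¹, p.2)) :=
  ((MeasurableEquiv.inv ℝ).prodCongr (MeasurableEquiv.refl ℝ)).measurableEmbedding

lemma logMeasure_ae_ne_one : ∀ᵐ τ ∂logMeasure, τ ≠ 1 := by
  refine (withDensity_absolutelyContinuous _ _).ae_le ?_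
  exact ae_restrict_of_ae (by simp [ae_iff])

/-- Folding an integral over `(0, ∞)` to `(1, ∞)` by the inversion. -/
lemma integral_eq_integral_add_inv (n : ℕ) {g : ℝ × ℝ → ℝ}
    (hg : Integrable g (logMeasure.prod (angleMeasure n))) :
    ∫ p, g p ∂(logMeasure.prod (angleMeasure n)) =
      (∫ p in {p | 1 < p.1}, g p ∂(logMeasure.prod (angleMeasure n))) +
      ∫ p in {p | 1 < p.1}, g (p.1⁻¹, p.2) ∂(logMeasure.prod (angleMeasure n)) := by
  have hS : MeasurableSet {p : ℝ × ℝ | 1 < p.1} := measurableSet_lt (by fun_prop) (by fun_prop)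
  rw [← integral_add_compl hS hg]
  congr 1
  rw [← (measurePreserving_inv_prod n).setIntegral_preimage_emb measurableEmbedding_inv_prod]
  -- The two domains can differ only where τ = 1 or τ ≤ 0, a null set for dτ/τ.
  refine setIntegral_congr_set ?_
  filter_upwards [prod_ae_pos n, Measure.quasiMeasurePreserving_fst.ae logMeasure_ae_ne_one]
    with p hp hp'
  refine propext ?_
  change ¬ (1 < p.1⁻¹) ↔ 1 < p.1
  rw [not_lt, inv_le_one₀ hp]
  exact ⟨fun h => lt_of_le_of_ne h (Ne.symm hp'), le_of_lt⟩

/-! ### Absolute convergence of the radial integral -/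

/-- The kernel `τ (τ² - 1) ^ (-1 - 2 s) H(τ)`. -/
noncomputable def kern (n : ℕ) (s τ : ℝ) : ℝ := τ * (τ ^ 2 - 1) ^ (-1 - 2 * s) * H n s τ

/-- The symmetrized difference of the profile `u` at `r`. -/
noncomputable def symDiff (n : ℕ) (s : ℝ) (u : ℝ → ℝ) (r τ : ℝ) : ℝ :=
  u r - u (r * τ) + (u r - u (r / τ)) * τ ^ (-(n : ℝ) + 2 * s)

lemma kern_nonneg {n : ℕ} (hn : 2 ≤ n) {s : ℝ} (hs : 0 < s) {τ : ℝ} (hτ : 1 < τ) :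
    0 ≤ kern n s τ :=
  mul_nonneg (mul_nonneg (by linarith) (rpow_nonneg (by nlinarith) _)) (H_pos hn hs hτ.le).le

lemma continuousOn_kern (n : ℕ) {s : ℝ} (hs : 0 < s) : ContinuousOn (kern n s) (Ioi 1) := by
  refine ContinuousOn.mul (continuousOn_id.mul (ContinuousOn.rpow_const (by fun_prop) ?_))
    ((continuousOn_H n hs).mono Ioi_subset_Ici_self)
  intro τ hτ
  rw [mem_Ioi] at hτ
  exact Or.inl (by nlinarith)

lemma continuousOn_symDiff (n : ℕ) (s : ℝ) {u : ℝ → ℝ} (hu : ContinuousOn u (Ioi 0)) {r : ℝ}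
    (hr : 0 < r) : ContinuousOn (symDiff n s u r) (Ioi 0) := by
  have h1 : ContinuousOn (fun τ => u (r * τ)) (Ioi 0) :=
    hu.comp (by fun_prop) fun τ hτ => mul_pos hr hτ
  have h2 : ContinuousOn (fun τ => u (r / τ)) (Ioi 0) :=
    hu.comp (continuousOn_const.div continuousOn_id fun τ hτ => ne_of_gt hτ)
      fun τ hτ => div_pos hr hτ
  exact (continuousOn_const.sub h1).add ((continuousOn_const.sub h2).mul
    (continuousOn_id.rpow_const fun τ hτ => Or.inl (ne_of_gt hτ)))

/-- At τ = 1 the derivatives of u(rτ) and u(r/τ) are opposite, and the derivative of the weight is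
multiplied by zero; value and slope both vanish, and Taylor's theorem gives the quadratic bound. -/
lemma abs_symDiff_le (n : ℕ) (s : ℝ) {u : ℝ → ℝ} (hu : ContDiffOn ℝ 2 u (Ioi 0)) {r : ℝ}
    (hr : 0 < r) : ∃ C, 0 ≤ C ∧ ∀ τ ∈ Icc (1 : ℝ) 2, |symDiff n s u r τ| ≤ C * (τ - 1) ^ 2 := by
  have hsub : Icc (1 : ℝ) 2 ⊆ Ioi 0 := fun τ hτ => mem_Ioi.2 (by linarith [hτ.1])
  have h1 : ContDiffOn ℝ 2 (fun τ => u (r * τ)) (Ioi 0) :=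
    hu.comp (by fun_prop) fun τ hτ => mul_pos hr hτ
  have h2 : ContDiffOn ℝ 2 (fun τ => u (r / τ)) (Ioi 0) :=
    hu.comp (contDiffOn_const.div contDiffOn_id fun τ hτ => ne_of_gt hτ)
      fun τ hτ => div_pos hr hτ
  have h3 : ContDiffOn ℝ 2 (symDiff n s u r) (Ioi 0) :=
    (contDiffOn_const.sub h1).add ((contDiffOn_const.sub h2).mul
      (contDiffOn_id.rpow_const_of_ne fun τ hτ => ne_of_gt hτ))
  obtain ⟨C, hC⟩ := exists_taylor_mean_remainder_bound (n := 1) (by norm_num : (1 : ℝ) ≤ 2)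
    (h3.mono hsub)
  have hd : HasDerivAt u (deriv u r) r :=
    ((hu.contDiffAt (Ioi_mem_nhds hr)).differentiableAt (by norm_num)).hasDerivAt
  have hder : HasDerivAt (symDiff n s u r) 0 1 := by
    have e1 : HasDerivAt (fun τ => u (r * τ)) (deriv u r * r) 1 := by
      have := HasDerivAt.comp (h₂ := u) (h := fun τ => r * τ) (1 : ℝ)
        (show HasDerivAt u (deriv u r) (r * 1) by rwa [mul_one]) ((hasDerivAt_id (1 : ℝ)).const_mul r)
      simpa [Function.comp_def] using this
    have e2 : HasDerivAt (fun τ => u (r / τ)) (deriv u r * (-r)) 1 := by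
      have := HasDerivAt.comp (h₂ := u) (h := fun τ => r * τ⁻¹) (1 : ℝ)
        (show HasDerivAt u (deriv u r) (r * 1⁻¹) by rwa [inv_one, mul_one]) ((hasDerivAt_inv (one_ne_zero (α := ℝ))).const_mul r)
      simpa [Function.comp_def, div_eq_mul_inv] using this
    have e3 := (hasDerivAt_id (1 : ℝ)).rpow_const (p := -(n : ℝ) + 2 * s) (Or.inl one_ne_zero)
    have := (e1.const_sub (u r)).add ((e2.const_sub (u r)).mul e3)
    refine this.congr_deriv ?_
    simp
  have hT : ∀ τ, taylorWithinEval (symDiff n s u r) 1 (Icc 1 2) 1 τ = 0 := by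
    intro τ
    have : derivWithin (symDiff n s u r) (Icc 1 2) 1 = 0 :=
      hder.hasDerivWithinAt.derivWithin (uniqueDiffOn_Icc (by norm_num) 1 ⟨le_rfl, by norm_num⟩)
    rw [taylorWithinEval_succ, taylor_within_zero_eval, zero_add, iteratedDerivWithin_one, this]
    simp [symDiff]
  refine ⟨max C 0, le_max_right _ _, fun τ hτ => ?_⟩
  have h := hC τ hτ
  rw [hT, sub_zero, norm_eq_abs] at h
  refine h.trans ?_
  exact mul_le_mul_of_nonneg_right (le_max_left _ _) (sq_nonneg _)

/-- Without the symmetric partner only first-order vanishing remains; this is what the truncation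
defect needs. -/
lemma abs_sub_div_le {u : ℝ → ℝ} (hu : ContDiffOn ℝ 2 u (Ioi 0)) {r : ℝ}
    (hr : 0 < r) : ∃ C, 0 ≤ C ∧ ∀ τ ∈ Icc (1 : ℝ) 2, |u r - u (r / τ)| ≤ C * (τ - 1) := by
  have h2 : ContDiffOn ℝ 2 (fun τ => u (r / τ)) (Ioi 0) :=
    hu.comp (contDiffOn_const.div contDiffOn_id fun τ hτ => ne_of_gt hτ)
      fun τ hτ => div_pos hr hτ
  have hsub : Icc (1 : ℝ) 2 ⊆ Ioi 0 := fun τ hτ => mem_Ioi.2 (by linarith [hτ.1])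
  obtain ⟨C, hC⟩ := exists_taylor_mean_remainder_bound (n := 0) (by norm_num : (1 : ℝ) ≤ 2)
    ((h2.mono hsub).of_le (by norm_num))
  refine ⟨max C 0, le_max_right _ _, fun τ hτ => ?_⟩
  have h := hC τ hτ
  rw [taylor_within_zero_eval, div_one, zero_add, pow_one, norm_eq_abs] at h
  rw [abs_sub_comm]
  refine h.trans ?_
  have : 0 ≤ τ - 1 := by linarith [hτ.1]
  gcongr
  exact le_max_left _ _

lemma integrable_logMeasure_iff {f : ℝ → ℝ} :
    Integrable f logMeasure ↔ IntegrableOn (fun τ => τ⁻¹ * f τ) (Ioi 0) := by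
  rw [logMeasure, integrable_withDensity_iff_integrable_smul' (by fun_prop)
    (Eventually.of_forall fun _ => ENNReal.ofReal_lt_top)]
  refine integrable_congr ?_
  filter_upwards [ae_restrict_mem measurableSet_Ioi] with τ hτ
  rw [mem_Ioi] at hτ
  rw [ENNReal.toReal_ofReal (by positivity), smul_eq_mul]

lemma logMeasure_restrict {S : Set ℝ} (hS : MeasurableSet S) (hS' : S ⊆ Ioi 0) :
    logMeasure.restrict S = (volume.restrict S).withDensity fun τ => ENNReal.ofReal τ⁻¹ := by
  rw [logMeasure, restrict_withDensity hS, Measure.restrict_restrict hS,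
    inter_eq_left.2 hS']

lemma integrableOn_logMeasure_iff {f : ℝ → ℝ} :
    IntegrableOn f (Ioi 1) logMeasure ↔ IntegrableOn (fun τ => τ⁻¹ * f τ) (Ioi 1) := by
  rw [IntegrableOn, logMeasure_restrict measurableSet_Ioi (Ioi_subset_Ioi zero_le_one),
    integrable_withDensity_iff_integrable_smul' (by fun_prop)
    (Eventually.of_forall fun _ => ENNReal.ofReal_lt_top)]
  refine integrable_congr ?_
  filter_upwards [ae_restrict_mem measurableSet_Ioi] with τ hτ
  rw [mem_Ioi] at hτ
  rw [ENNReal.toReal_ofReal (by positivity), smul_eq_mul]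

lemma setIntegral_logMeasure (f : ℝ → ℝ) :
    ∫ τ in Ioi 1, f τ ∂logMeasure = ∫ τ in Ioi 1, τ⁻¹ * f τ := by
  rw [logMeasure_restrict measurableSet_Ioi (Ioi_subset_Ioi zero_le_one),
    integral_withDensity_eq_integral_toReal_smul (by fun_prop)
    (Eventually.of_forall fun _ => ENNReal.ofReal_lt_top)]
  refine integral_congr_ae ?_
  filter_upwards [ae_restrict_mem measurableSet_Ioi] with τ hτ
  rw [mem_Ioi] at hτ
  rw [ENNReal.toReal_ofReal (by positivity), smul_eq_mul]

/-- The weighted profile whose integrability is assumed. -/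
noncomputable def weighted (n : ℕ) (s : ℝ) (u : ℝ → ℝ) (ρ : ℝ) : ℝ :=
  |u ρ| / (1 + ρ) ^ ((n : ℝ) + 2 * s) * ρ ^ (n - 1)

lemma integrableOn_weighted_mul {n : ℕ} {s : ℝ} {u : ℝ → ℝ}
    (hI : IntegrableOn (weighted n s u) (Ioi 0)) {r : ℝ} (hr : 0 < r) :
    IntegrableOn (fun τ => weighted n s u (r * τ)) (Ioi 0) := by
  rw [integrableOn_Ioi_comp_mul_left_iff _ _ hr, mul_zero]
  exact hI

lemma integrableOn_weighted_div {n : ℕ} {s : ℝ} {u : ℝ → ℝ}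
    (hI : IntegrableOn (weighted n s u) (Ioi 0)) {r : ℝ} (hr : 0 < r) :
    IntegrableOn (fun τ => (τ ^ 2)⁻¹ * weighted n s u (r / τ)) (Ioi 0) := by
  have h1 : Integrable (fun τ => τ * weighted n s u (r * τ)) logMeasure := by
    rw [integrable_logMeasure_iff]
    refine (integrableOn_weighted_mul hI hr).congr_fun (fun τ hτ => ?_) measurableSet_Ioi
    have : τ ≠ 0 := ne_of_gt hτ
    field_simp
  have h2 := (measurePreserving_inv_logMeasure.integrable_comp_emb
    (MeasurableEquiv.inv ℝ).measurableEmbedding).2 h1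
  rw [integrable_logMeasure_iff] at h2
  refine h2.congr_fun (fun τ hτ => ?_) measurableSet_Ioi
  simp only [Function.comp, div_eq_mul_inv]
  ring

/-- For τ ≥ 1, 1 + rτ ≤ (1+r)τ, so the integrability weight at rτ is at least a constant times
τ^(-1-2s). -/
lemma weighted_mul_ge {n : ℕ} (hn : 2 ≤ n) {s : ℝ} (hs : 0 < s) (u : ℝ → ℝ) {r τ : ℝ}
    (hr : 0 < r) (hτ : 1 ≤ τ) :
    |u (r * τ)| * τ ^ (-1 - 2 * s) ≤
      (1 + r) ^ ((n : ℝ) + 2 * s) / r ^ (n - 1) * weighted n s u (r * τ) := by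
  have h0 : 0 < τ := by linarith
  have h1 : (1 + r * τ) ^ ((n : ℝ) + 2 * s) ≤ ((1 + r) * τ) ^ ((n : ℝ) + 2 * s) :=
    rpow_le_rpow (by positivity) (by nlinarith) (by positivity)
  rw [mul_rpow (by positivity) h0.le] at h1
  have h2 : τ ^ (-1 - 2 * s) * τ ^ ((n : ℝ) + 2 * s) = τ ^ (n - 1) := by
    rw [← rpow_add h0, ← rpow_natCast, Nat.cast_sub (by omega)]
    congr 1; push_cast; ring
  unfold weighted
  rw [mul_pow, div_mul_eq_mul_div, div_mul_eq_mul_div, mul_div_assoc', le_div_iff₀ (by positivity),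
    le_div_iff₀ (by positivity)]
  calc |u (r * τ)| * τ ^ (-1 - 2 * s) * r ^ (n - 1) * (1 + r * τ) ^ ((n : ℝ) + 2 * s)
      ≤ |u (r * τ)| * τ ^ (-1 - 2 * s) * r ^ (n - 1) *
        ((1 + r) ^ ((n : ℝ) + 2 * s) * τ ^ ((n : ℝ) + 2 * s)) := by gcongr
    _ = |u (r * τ)| * r ^ (n - 1) * (1 + r) ^ ((n : ℝ) + 2 * s) *
        (τ ^ (-1 - 2 * s) * τ ^ ((n : ℝ) + 2 * s)) := by ring
    _ = _ := by rw [h2]; ring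

/-- The weight at r/τ is at least a constant times τ^(1-n); the remaining τ^(-2) is the Jacobian of
the inversion. -/
lemma weighted_div_ge {n : ℕ} (hn : 2 ≤ n) {s : ℝ} (hs : 0 < s) (u : ℝ → ℝ) {r τ : ℝ}
    (hr : 0 < r) (hτ : 1 ≤ τ) :
    |u (r / τ)| * (τ ^ (-(n : ℝ) + 2 * s) * τ ^ (-1 - 2 * s)) ≤
      (1 + r) ^ ((n : ℝ) + 2 * s) / r ^ (n - 1) * ((τ ^ 2)⁻¹ * weighted n s u (r / τ)) := by
  have h0 : 0 < τ := by linarith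
  have h1 : (1 + r / τ) ^ ((n : ℝ) + 2 * s) ≤ (1 + r) ^ ((n : ℝ) + 2 * s) :=
    rpow_le_rpow (by positivity) (by gcongr; exact div_le_self hr.le hτ) (by positivity)
  have h2 : τ ^ (-(n : ℝ) + 2 * s) * τ ^ (-1 - 2 * s) = (τ ^ 2)⁻¹ * (τ ^ (n - 1))⁻¹ := by
    rw [← rpow_add h0, ← mul_inv, ← pow_add, ← rpow_natCast, ← rpow_neg h0.le]
    congr 1
    rw [show 2 + (n - 1) = n + 1 by omega]; push_cast; ring
  unfold weighted
  rw [h2, div_pow]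
  have h3 : 1 ≤ (1 + r) ^ ((n : ℝ) + 2 * s) / (1 + r / τ) ^ ((n : ℝ) + 2 * s) :=
    (one_le_div (by positivity)).2 h1
  calc |u (r / τ)| * ((τ ^ 2)⁻¹ * (τ ^ (n - 1))⁻¹)
      ≤ |u (r / τ)| * ((τ ^ 2)⁻¹ * (τ ^ (n - 1))⁻¹) *
        ((1 + r) ^ ((n : ℝ) + 2 * s) / (1 + r / τ) ^ ((n : ℝ) + 2 * s)) :=
        le_mul_of_one_le_right (by positivity) h3
    _ = _ := by field_simp

lemma integrableOn_sub_one_rpow {a : ℝ} (ha : -1 < a) :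
    IntegrableOn (fun τ : ℝ => (τ - 1) ^ a) (Ioc 1 2) := by
  have h := (intervalIntegral.intervalIntegrable_rpow' (a := 0) (b := 1) ha).comp_sub_right 1
  rw [intervalIntegrable_iff_integrableOn_Ioc_of_le (by norm_num)] at h
  norm_num at h
  exact h

/-- Near 1 the product is O((τ-1)^(1-2s)), integrable because s < 1. Beyond 2 the kernel is
O(τ^(-1-2s)), and the growth hypothesis controls both values of u. -/
lemma integrableOn_symDiff_mul_kern {n : ℕ} (hn : 2 ≤ n) {s : ℝ} (hs : 0 < s) (hs1 : s < 1)
    {u : ℝ → ℝ} (hu : ContDiffOn ℝ 2 u (Ioi 0)) (hI : IntegrableOn (weighted n s u) (Ioi 0))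
    {r : ℝ} (hr : 0 < r) : IntegrableOn (fun τ => symDiff n s u r τ * kern n s τ) (Ioi 1) := by
  have hn' : (2 : ℝ) ≤ n := by exact_mod_cast hn
  obtain ⟨_, C₂, _, hC₂, hk⟩ := kernel_bounds hn hs
  have hcont : ContinuousOn (fun τ => symDiff n s u r τ * kern n s τ) (Ioi 1) :=
    ((continuousOn_symDiff n s hu.continuousOn hr).mono (Ioi_subset_Ioi zero_le_one)).mul
      (continuousOn_kern n hs)
  rw [← Ioc_union_Ioi_eq_Ioi (by norm_num : (1 : ℝ) ≤ 2)]
  refine IntegrableOn.union ?_ ?_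
  · obtain ⟨C, hC, hh⟩ := abs_symDiff_le n s hu hr
    refine ((integrableOn_sub_one_rpow (a := 1 - 2 * s) (by linarith)).const_mul (C * C₂)).mono'
      ((hcont.mono Ioc_subset_Ioi_self).aestronglyMeasurable measurableSet_Ioc) ?_
    filter_upwards [ae_restrict_mem measurableSet_Ioc] with τ hτ
    rw [norm_mul, norm_of_nonneg (kern_nonneg hn hs hτ.1), norm_eq_abs]
    have h1 := hh τ ⟨hτ.1.le, hτ.2⟩
    have h2 := (hk τ hτ.1).2
    have h0 : 0 < τ - 1 := by linarith [hτ.1]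
    calc |symDiff n s u r τ| * kern n s τ
        ≤ (C * (τ - 1) ^ 2) * (C₂ * (τ - 1) ^ (-1 - 2 * s)) := by
          exact mul_le_mul h1 h2 (kern_nonneg hn hs hτ.1) (by positivity)
      _ = C * C₂ * (τ - 1) ^ (1 - 2 * s) := by
          rw [show (1 - 2 * s : ℝ) = 2 + (-1 - 2 * s) by ring, rpow_add h0 2, rpow_two]
          ring
  · set B := (1 + r) ^ ((n : ℝ) + 2 * s) / r ^ (n - 1)
    have i1 : IntegrableOn (fun τ : ℝ => τ ^ (-1 - 2 * s)) (Ioi 2) :=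
      integrableOn_Ioi_rpow_of_lt (by linarith) (by norm_num)
    have hs2 : Ioi (2 : ℝ) ⊆ Ioi 0 := Ioi_subset_Ioi (by norm_num)
    have i2 := (integrableOn_weighted_mul hI hr).mono_set hs2
    have i3 := (integrableOn_weighted_div hI hr).mono_set hs2
    refine ((((i1.const_mul (2 * |u r|)).add (i2.const_mul B)).add (i3.const_mul B)).const_mul
      (C₂ * (1 / 2) ^ (-1 - 2 * s))).mono'
      ((hcont.mono (Ioi_subset_Ioi (by norm_num))).aestronglyMeasurable measurableSet_Ioi) ?_
    filter_upwards [ae_restrict_mem measurableSet_Ioi] with τ hτ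
    rw [mem_Ioi] at hτ
    have h1 : 1 < τ := by linarith
    have h0 : 0 < τ := by linarith
    rw [norm_mul, norm_of_nonneg (kern_nonneg hn hs h1), norm_eq_abs]
    -- For τ > 2 one has τ - 1 ≥ τ/2.
    have hkern : kern n s τ ≤ C₂ * (1 / 2) ^ (-1 - 2 * s) * τ ^ (-1 - 2 * s) := by
      refine (hk τ h1).2.trans ?_
      rw [mul_assoc, ← mul_rpow (by norm_num) h0.le]
      refine mul_le_mul_of_nonneg_left ?_ hC₂.le
      exact rpow_le_rpow_of_nonpos (by linarith) (by linarith) (by linarith)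
    have hpow : τ ^ (-(n : ℝ) + 2 * s) ≤ 1 :=
      rpow_le_one_of_one_le_of_nonpos h1.le (by linarith)
    have hsym : |symDiff n s u r τ| ≤
        2 * |u r| + |u (r * τ)| + |u (r / τ)| * τ ^ (-(n : ℝ) + 2 * s) := by
      have hp : 0 ≤ τ ^ (-(n : ℝ) + 2 * s) := by positivity
      unfold symDiff
      calc _ ≤ |u r - u (r * τ)| + |(u r - u (r / τ)) * τ ^ (-(n : ℝ) + 2 * s)| := abs_add_le _ _
        _ ≤ (|u r| + |u (r * τ)|) + (|u r| + |u (r / τ)|) * τ ^ (-(n : ℝ) + 2 * s) := by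
          rw [abs_mul, abs_of_nonneg hp]
          gcongr
          · exact abs_sub _ _
          · exact abs_sub _ _
        _ ≤ _ := by nlinarith [abs_nonneg (u r)]
    have w1 := weighted_mul_ge hn hs u hr h1.le
    have w2 := weighted_div_ge hn hs u hr h1.le
    calc |symDiff n s u r τ| * kern n s τ
        ≤ (2 * |u r| + |u (r * τ)| + |u (r / τ)| * τ ^ (-(n : ℝ) + 2 * s)) *
          (C₂ * (1 / 2) ^ (-1 - 2 * s) * τ ^ (-1 - 2 * s)) := by
          gcongr
          exact kern_nonneg hn hs h1
      _ = C₂ * (1 / 2) ^ (-1 - 2 * s) * (2 * |u r| * τ ^ (-1 - 2 * s) +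
          |u (r * τ)| * τ ^ (-1 - 2 * s) +
          |u (r / τ)| * (τ ^ (-(n : ℝ) + 2 * s) * τ ^ (-1 - 2 * s))) := by ring
      _ ≤ _ := by
          simp only [Pi.add_apply]
          gcongr

/-! ### Integrating out the angle -/

lemma integral_distSq_angleMeasure {n : ℕ} (hn : 2 ≤ n) (s : ℝ) {τ : ℝ} (hτ : 1 < τ) :
    τ ^ n * ∫ φ, distSq τ φ ^ (-(((n : ℝ) + 2 * s) / 2)) ∂(angleMeasure n) =
      τ * kern n s τ := by
  have ha := alpha_pos hn
  rw [kern, kernel_eq hτ hn, angleMeasure, integral_withDensity_eq_integral_toReal_smul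
    (by fun_prop) (Eventually.of_forall fun _ => ENNReal.ofReal_lt_top),
    ← integral_Ioc_eq_integral_Ioo, ← intervalIntegral.integral_of_le pi_pos.le,
    ← intervalIntegral.integral_const_mul, ← intervalIntegral.integral_const_mul,
    ← intervalIntegral.integral_const_mul]
  refine intervalIntegral.integral_congr fun φ hφ => ?_
  rw [uIcc_of_le pi_pos.le] at hφ
  have hs := sin_nonneg_of_mem_Icc hφ
  rw [ENNReal.toReal_ofReal (by positivity), smul_eq_mul,
    show τ ^ n = τ * τ ^ (n - 1) by rw [← pow_succ']; congr 1; omega]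
  ring

lemma integrable_distSq_angleMeasure (n : ℕ) (a : ℝ) {τ : ℝ} (hτ : 1 < τ) :
    Integrable (fun φ => distSq τ φ ^ a) (angleMeasure n) := by
  have hc : Continuous fun φ => distSq τ φ ^ a := by
    refine Continuous.rpow_const ?_ fun φ => Or.inl (distSq_pos (by linarith) hτ.ne' φ).ne'
    exact continuous_distSq.comp (by fun_prop : Continuous fun φ : ℝ => (τ, φ))
  obtain ⟨C, hC⟩ := (isCompact_Icc (a := (0 : ℝ)) (b := π)).exists_bound_of_continuousOn
    hc.continuousOn
  have h : ∀ᵐ φ ∂(volume.restrict (Ioo (0 : ℝ) π)), ‖distSq τ φ ^ a‖ ≤ C := by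
    filter_upwards [ae_restrict_mem measurableSet_Ioo] with φ hφ
    exact hC φ ⟨hφ.1.le, hφ.2.le⟩
  exact Integrable.of_bound hc.aestronglyMeasurable C
    ((withDensity_absolutelyContinuous _ _).ae_le h)

lemma restrict_prod_eq (n : ℕ) :
    (logMeasure.prod (angleMeasure n)).restrict {p | 1 < p.1} =
      (logMeasure.restrict (Ioi 1)).prod (angleMeasure n) := by
  rw [← Measure.restrict_univ (μ := angleMeasure n), Measure.prod_restrict,
    Measure.restrict_univ (μ := angleMeasure n)]
  congr 1
  ext p
  simp

/-- The angular factor is positive, so integrating the absolute value over φ first reduces joint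
integrability to that of h times the kernel. The extra τ from the angular integral cancels the
density 1/τ. -/
lemma integrable_mul_distSq {n : ℕ} (hn : 2 ≤ n) {s : ℝ} (hs : 0 < s) {h : ℝ → ℝ}
    (hm : Measurable h) (hint : IntegrableOn (fun τ => h τ * kern n s τ) (Ioi 1)) :
    IntegrableOn (fun p : ℝ × ℝ => p.1 ^ n * (h p.1 * distSq p.1 p.2 ^ (-(((n : ℝ) + 2 * s) / 2))))
      {p | 1 < p.1} (logMeasure.prod (angleMeasure n)) ∧
    ∫ p in {p | 1 < p.1}, p.1 ^ n * (h p.1 * distSq p.1 p.2 ^ (-(((n : ℝ) + 2 * s) / 2)))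
      ∂(logMeasure.prod (angleMeasure n)) = ∫ τ in Ioi 1, h τ * kern n s τ := by
  have hmeas : Measurable fun p : ℝ × ℝ =>
      p.1 ^ n * (h p.1 * distSq p.1 p.2 ^ (-(((n : ℝ) + 2 * s) / 2))) := by
    have := continuous_distSq.measurable
    fun_prop
  have hval : ∀ g : ℝ → ℝ, ∀ τ, 1 < τ →
      ∫ φ, τ ^ n * (g τ * distSq τ φ ^ (-(((n : ℝ) + 2 * s) / 2))) ∂(angleMeasure n) =
        τ * (g τ * kern n s τ) := by
    intro g τ hτ
    rw [integral_const_mul, integral_const_mul, mul_left_comm,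
      integral_distSq_angleMeasure hn s hτ]
    ring
  have key : Integrable (fun p : ℝ × ℝ =>
      p.1 ^ n * (h p.1 * distSq p.1 p.2 ^ (-(((n : ℝ) + 2 * s) / 2))))
      ((logMeasure.restrict (Ioi 1)).prod (angleMeasure n)) := by
    rw [integrable_prod_iff hmeas.aestronglyMeasurable]
    constructor
    · filter_upwards [ae_restrict_mem measurableSet_Ioi] with τ hτ
      exact ((integrable_distSq_angleMeasure n _ hτ).const_mul _).const_mul _
    · change IntegrableOn _ _ _
      rw [integrableOn_logMeasure_iff]
      refine IntegrableOn.congr_fun (Integrable.norm hint) (fun τ hτ => ?_) measurableSet_Ioi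
      rw [mem_Ioi] at hτ
      have h0 : 0 < τ := by linarith
      have hnorm : ∀ φ, ‖τ ^ n * (h τ * distSq τ φ ^ (-(((n : ℝ) + 2 * s) / 2)))‖ =
          τ ^ n * (|h τ| * distSq τ φ ^ (-(((n : ℝ) + 2 * s) / 2))) := by
        intro φ
        rw [norm_mul, norm_mul, norm_of_nonneg (by positivity), norm_eq_abs,
          norm_of_nonneg (rpow_nonneg (distSq_pos h0.le hτ.ne' φ).le _)]
      simp only [hnorm]
      rw [hval (fun τ => |h τ|) τ hτ, norm_mul, norm_eq_abs, norm_of_nonneg (kern_nonneg hn hs hτ)]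
      field_simp
  rw [IntegrableOn, restrict_prod_eq]
  refine ⟨key, ?_⟩
  rw [integral_prod _ key, setIntegral_logMeasure]
  refine setIntegral_congr_fun measurableSet_Ioi fun τ hτ => ?_
  rw [mem_Ioi] at hτ
  simp only [hval h τ hτ]
  have : τ ≠ 0 := by linarith
  field_simp

/-! ### Truncated integrals and shells -/

lemma lt_norm_sub_iff {n : ℕ} {x : EuclideanSpace ℝ (Fin n)} (hx : x ≠ 0) {a : ℝ} (ha : 0 ≤ a)
    (y : EuclideanSpace ℝ (Fin n)) :
    a ^ 2 < distSq (polar x y).1 (polar x y).2 ↔ a * ‖x‖ < ‖x - y‖ := by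
  have hr : 0 < ‖x‖ := norm_pos_iff.2 hx
  rw [← sq_lt_sq₀ (by positivity) (norm_nonneg _), norm_sub_sq_eq_distSq hx, mul_pow, mul_comm,
    mul_lt_mul_iff_right₀ (by positivity)]

/-- The polar form of a spherical shell around the base point. -/
def shell (a b : ℝ) : Set (ℝ × ℝ) := {p | a ^ 2 < distSq p.1 p.2 ∧ distSq p.1 p.2 ≤ b ^ 2}

lemma measurableSet_shell (a b : ℝ) : MeasurableSet (shell a b) :=
  (measurableSet_lt measurable_const continuous_distSq.measurable).inter
    (measurableSet_le continuous_distSq.measurable measurable_const)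

/-- Up to the factor |x|^n this is the volume of an annulus around x, computed back in ℝⁿ. -/
lemma integral_shell {n : ℕ} (hn : 2 ≤ n) {x : EuclideanSpace ℝ (Fin n)} (hx : x ≠ 0) {a b : ℝ}
    (ha : 0 ≤ a) (hab : a ≤ b) :
    Integrable (fun p => p.1 ^ n * (shell a b).indicator 1 p)
      (logMeasure.prod (angleMeasure n)) ∧
    ∫ p, p.1 ^ n * (shell a b).indicator 1 p ∂(logMeasure.prod (angleMeasure n)) =
      volume.real (Metric.ball (0 : EuclideanSpace ℝ (Fin n)) 1) * (b ^ n - a ^ n) := by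
  have hr : 0 < ‖x‖ := norm_pos_iff.2 hx
  have hm : Measurable ((shell a b).indicator (1 : ℝ × ℝ → ℝ)) :=
    measurable_one.indicator (measurableSet_shell a b)
  have hsub : Metric.closedBall x (a * ‖x‖) ⊆ Metric.closedBall x (b * ‖x‖) :=
    Metric.closedBall_subset_closedBall (by gcongr)
  have e : (fun y => (shell a b).indicator (1 : ℝ × ℝ → ℝ) (polar x y)) =
      (Metric.closedBall x (b * ‖x‖) \ Metric.closedBall x (a * ‖x‖)).indicator 1 := by
    ext y
    have h1 := lt_norm_sub_iff hx ha y
    have h2 := not_congr (lt_norm_sub_iff hx (ha.trans hab) y)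
    rw [not_lt, not_lt] at h2
    have h3 : polar x y ∈ shell a b ↔
        y ∈ Metric.closedBall x (b * ‖x‖) \ Metric.closedBall x (a * ‖x‖) := by
      rw [Set.mem_sdiff, Metric.mem_closedBall, Metric.mem_closedBall, dist_comm, dist_eq_norm, not_le,
        ← h1, ← h2]
      exact and_comm
    by_cases h : polar x y ∈ shell a b
    · rw [indicator_of_mem h, indicator_of_mem (h3.1 h)]; rfl
    · rw [indicator_of_notMem h, indicator_of_notMem (fun h' => h (h3.2 h'))]
  have hD : MeasurableSet (Metric.closedBall x (b * ‖x‖) \ Metric.closedBall x (a * ‖x‖)) :=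
    Metric.isClosed_closedBall.measurableSet.diff Metric.isClosed_closedBall.measurableSet
  have h1 := integral_polar hn hx hm
  have h2 := integrable_polar hn hx hm
  rw [e] at h1 h2
  constructor
  · refine h2.1 ((integrable_indicator_iff hD).2 ?_)
    exact integrableOn_const ((measure_mono sdiff_subset).trans_lt measure_closedBall_lt_top).ne
  · rw [integral_indicator_one hD, measureReal_sdiff hsub Metric.isClosed_closedBall.measurableSet
      measure_closedBall_lt_top.ne,
      Measure.addHaar_real_closedBall _ _ (mul_nonneg (ha.trans hab) hr.le),
      Measure.addHaar_real_closedBall _ _ (by positivity), finrank_euclideanSpace_fin] at h1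
    apply mul_left_cancel₀ (pow_ne_zero n hr.ne')
    rw [← h1]
    ring

lemma integrableOn_fracIntegrand {n : ℕ} (hn : 2 ≤ n) {s : ℝ} (hs : 0 < s) {u : ℝ → ℝ}
    (hum : Measurable u) (hI : IntegrableOn (weighted n s u) (Ioi 0))
    (x : EuclideanSpace ℝ (Fin n)) {ε : ℝ} (hε : 0 < ε) :
    IntegrableOn (fracIntegrand s (fun y => u ‖y‖) x) {y | ε < ‖x - y‖} := by
  have : NeZero n := ⟨by omega⟩
  have hp : 0 < (n : ℝ) + 2 * s := by positivity
  have hmeas : Measurable (fracIntegrand s (fun y : EuclideanSpace ℝ (Fin n) => u ‖y‖) x) := by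
    unfold fracIntegrand; fun_prop
  -- Chosen so that 1 + |y| ≤ 1 + |x| + |x-y| ≤ B|x-y| once |x-y| > ε.
  set B := (1 + ‖x‖) / ε + 1
  have i1 : Integrable fun y : EuclideanSpace ℝ (Fin n) => (1 + ‖y‖) ^ (-((n : ℝ) + 2 * s)) :=
    integrable_one_add_norm (by simpa using hs)
  have i2 : Integrable fun y : EuclideanSpace ℝ (Fin n) =>
      |u ‖y‖| / (1 + ‖y‖) ^ ((n : ℝ) + 2 * s) := by
    rw [integrable_fun_norm_addHaar volume (f := fun ρ => |u ρ| / (1 + ρ) ^ ((n : ℝ) + 2 * s))]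
    rw [finrank_euclideanSpace_fin]
    refine hI.congr_fun (fun ρ _ => ?_) measurableSet_Ioi
    simp only [weighted, smul_eq_mul]
    ring
  refine (((i1.const_mul |u ‖x‖|).add i2).const_mul
    (B ^ ((n : ℝ) + 2 * s))).integrableOn.mono' hmeas.aestronglyMeasurable ?_
  have hS : MeasurableSet {y : EuclideanSpace ℝ (Fin n) | ε < ‖x - y‖} :=
    measurableSet_lt (by fun_prop) (by fun_prop)
  filter_upwards [ae_restrict_mem hS] with y hy
  have hd : ε < ‖x - y‖ := hy
  have hd0 : 0 < ‖x - y‖ := hε.trans hd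
  have h1 : 1 + ‖y‖ ≤ B * ‖x - y‖ := by
    have h2 : ‖y‖ ≤ ‖x‖ + ‖x - y‖ := by
      have := norm_sub_le x (x - y)
      rwa [sub_sub_cancel] at this
    have h3 : 1 + ‖x‖ ≤ (1 + ‖x‖) / ε * ‖x - y‖ := by
      rw [div_mul_eq_mul_div, le_div_iff₀ hε]
      gcongr
    simp only [B]
    linarith
  have hB : 0 < B := by positivity
  have h4 : (1 + ‖y‖) ^ ((n : ℝ) + 2 * s) ≤
      B ^ ((n : ℝ) + 2 * s) * ‖x - y‖ ^ ((n : ℝ) + 2 * s) := by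
    rw [← mul_rpow hB.le hd0.le]
    exact rpow_le_rpow (by positivity) h1 hp.le
  unfold fracIntegrand
  rw [norm_div, norm_eq_abs, norm_of_nonneg (by positivity)]
  simp only [Pi.add_apply]
  rw [rpow_neg (by positivity), ← div_eq_mul_inv, ← add_div, mul_div_assoc',
    div_le_div_iff₀ (by positivity) (by positivity)]
  calc |u ‖x‖ - u ‖y‖| * (1 + ‖y‖) ^ ((n : ℝ) + 2 * s)
      ≤ (|u ‖x‖| + |u ‖y‖|) * (B ^ ((n : ℝ) + 2 * s) * ‖x - y‖ ^ ((n : ℝ) + 2 * s)) := by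
        gcongr
        exact abs_sub _ _
    _ = _ := by ring

/-- Differentiability bounds the integrand near x by a multiple of |x-y|^(1-n-2s), locally
integrable exactly when s < 1/2. -/
lemma integrable_fracIntegrand {n : ℕ} (hn : 2 ≤ n) {s : ℝ} (hs : 0 < s) (hs2 : s < 1 / 2)
    {u : ℝ → ℝ} (hum : Measurable u) (hI : IntegrableOn (weighted n s u) (Ioi 0))
    {x : EuclideanSpace ℝ (Fin n)} (hd : DifferentiableAt ℝ u ‖x‖) :
    Integrable (fracIntegrand s (fun y => u ‖y‖) x) := by
  have : NeZero n := ⟨by omega⟩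
  have hmeas : Measurable (fracIntegrand s (fun y : EuclideanSpace ℝ (Fin n) => u ‖y‖) x) := by
    unfold fracIntegrand; fun_prop
  obtain ⟨C, hC, hb⟩ := hd.isBigO_sub.exists_pos
  obtain ⟨ε, hε, hball⟩ := Metric.eventually_nhds_iff.1 hb.bound
  have hint := integrableOn_fracIntegrand hn hs hum hI x (half_pos hε)
  have hS : MeasurableSet {y : EuclideanSpace ℝ (Fin n) | ε / 2 < ‖x - y‖} :=
    measurableSet_lt (by fun_prop) (by fun_prop)
  rw [← integrableOn_univ, ← union_compl_self {y : EuclideanSpace ℝ (Fin n) | ε / 2 < ‖x - y‖}]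
  refine hint.union ?_
  have i1 : IntegrableOn (fun z : EuclideanSpace ℝ (Fin n) => ‖z‖ ^ (1 - ((n : ℝ) + 2 * s)))
      (Metric.ball 0 ε) := by
    rw [integrableOn_fun_norm_addHaar volume (f := fun ρ => ρ ^ (1 - ((n : ℝ) + 2 * s))),
      finrank_euclideanSpace_fin]
    have h := (intervalIntegral.intervalIntegrable_rpow' (a := 0) (b := ε) (r := -2 * s)
      (by linarith))
    rw [intervalIntegrable_iff_integrableOn_Ioo_of_le hε.le] at h
    refine h.congr_fun (fun ρ hρ => ?_) measurableSet_Ioo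
    simp only [smul_eq_mul]
    rw [← rpow_natCast, ← rpow_add hρ.1, Nat.cast_sub (by omega)]
    congr 1
    push_cast
    ring
  have i2 := ((integrable_indicator_iff Metric.isOpen_ball.measurableSet).2 i1).comp_sub_left x
  refine ((i2.const_mul C).integrableOn (s := {y | ε / 2 < ‖x - y‖}ᶜ)).mono'
    hmeas.aestronglyMeasurable ?_
  filter_upwards [ae_restrict_mem hS.compl] with y hy
  have hy' : ‖x - y‖ ≤ ε / 2 := not_lt.1 hy
  rw [indicator_of_mem (by rw [mem_ball_zero_iff]; linarith)]
  unfold fracIntegrand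
  rcases (norm_nonneg (x - y)).eq_or_lt with h0 | h0
  · have : x = y := sub_eq_zero.1 (norm_eq_zero.1 h0.symm)
    simp only [this, sub_self, zero_div, norm_zero]
    positivity
  have hdist : |‖y‖ - ‖x‖| ≤ ‖x - y‖ := by
    rw [norm_sub_rev x y]; exact abs_norm_sub_norm_le y x
  have h1 := hball (y := ‖y‖) (by rw [dist_eq_norm, norm_eq_abs]; linarith)
  rw [norm_eq_abs, norm_eq_abs] at h1
  rw [norm_div, norm_eq_abs, abs_sub_comm, norm_of_nonneg (by positivity), rpow_sub h0, rpow_one,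
    mul_div_assoc']
  gcongr
  exact h1.trans (by gcongr)

/-! ### The principal value and the symmetry defect -/

/-- The integrand of the fractional Laplacian in polar coordinates, truncated at distance `δ`. -/
noncomputable def truncated (n : ℕ) (s : ℝ) (u : ℝ → ℝ) (r δ : ℝ) (p : ℝ × ℝ) : ℝ :=
  {p : ℝ × ℝ | δ ^ 2 < distSq p.1 p.2}.indicator
    (fun p => (u r - u (r * p.1)) * distSq p.1 p.2 ^ (-(((n : ℝ) + 2 * s) / 2))) p

lemma measurable_truncated (n : ℕ) (s : ℝ) {u : ℝ → ℝ} (hum : Measurable u) (r δ : ℝ) :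
    Measurable (truncated n s u r δ) := by
  have h := continuous_distSq.measurable
  unfold truncated
  exact Measurable.indicator (by fun_prop) (measurableSet_lt measurable_const h)

lemma indicator_fracIntegrand_eq {n : ℕ} (s : ℝ) (u : ℝ → ℝ) {x : EuclideanSpace ℝ (Fin n)}
    (hx : x ≠ 0) {δ : ℝ} (hδ : 0 ≤ δ) (y : EuclideanSpace ℝ (Fin n)) :
    {y | δ * ‖x‖ < ‖x - y‖}.indicator (fracIntegrand s (fun y => u ‖y‖) x) y =
      ‖x‖ ^ (-((n : ℝ) + 2 * s)) * truncated n s u ‖x‖ δ (polar x y) := by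
  have hr : 0 < ‖x‖ := norm_pos_iff.2 hx
  have h1 := lt_norm_sub_iff hx hδ y
  unfold truncated
  by_cases h : δ * ‖x‖ < ‖x - y‖
  · rw [indicator_of_mem (show y ∈ {y | δ * ‖x‖ < ‖x - y‖} from h),
      indicator_of_mem (show polar x y ∈ {p : ℝ × ℝ | δ ^ 2 < distSq p.1 p.2} from h1.2 h)]
    have hpos : 0 < distSq (polar x y).1 (polar x y).2 := (sq_nonneg δ).trans_lt (h1.2 h)
    have hn : ‖x - y‖ = ‖x‖ * √(distSq (polar x y).1 (polar x y).2) := by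
      rw [← sqrt_sq (norm_nonneg (x - y)), norm_sub_sq_eq_distSq hx, sqrt_mul (by positivity),
        sqrt_sq hr.le]
    have h2 : ‖x‖ * (polar x y).1 = ‖y‖ := by simp only [polar]; field_simp
    rw [fracIntegrand, hn, h2, mul_rpow hr.le (sqrt_nonneg _), sqrt_eq_rpow, ← rpow_mul hpos.le,
      rpow_neg hr.le, rpow_neg hpos.le, show 1 / 2 * ((n : ℝ) + 2 * s) = ((n : ℝ) + 2 * s) / 2 by
      ring]
    have h3 := (rpow_pos_of_pos hpos (((n : ℝ) + 2 * s) / 2)).ne'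
    have h4 := (rpow_pos_of_pos hr ((n : ℝ) + 2 * s)).ne'
    field_simp
  · rw [indicator_of_notMem (show y ∉ {y | δ * ‖x‖ < ‖x - y‖} from h),
      indicator_of_notMem (show polar x y ∉ {p : ℝ × ℝ | δ ^ 2 < distSq p.1 p.2} from
        fun h' => h (h1.1 h')), mul_zero]

lemma distSq_inv {τ : ℝ} (hτ : 0 < τ) (φ : ℝ) : distSq τ⁻¹ φ = distSq τ φ / τ ^ 2 := by
  unfold distSq
  field_simp
  ring

/-- The sum of the truncated integrand and its inversion, up to the defect of symmetry
of the truncation. -/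
lemma truncated_add_inv (n : ℕ) (s : ℝ) (u : ℝ → ℝ) (r : ℝ) {δ : ℝ}
    {p : ℝ × ℝ} (hp : 1 < p.1) :
    p.1 ^ n * truncated n s u r δ p + p.1⁻¹ ^ n * truncated n s u r δ (p.1⁻¹, p.2) =
      {p : ℝ × ℝ | δ ^ 2 < distSq p.1 p.2}.indicator (fun p => p.1 ^ n *
        (symDiff n s u r p.1 * distSq p.1 p.2 ^ (-(((n : ℝ) + 2 * s) / 2)))) p -
      {p : ℝ × ℝ | δ ^ 2 < distSq p.1 p.2 ∧ distSq p.1 p.2 ≤ (δ * p.1) ^ 2}.indicator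
        (fun p => p.1 ^ n * ((u r - u (r / p.1)) * p.1 ^ (-(n : ℝ) + 2 * s) *
          distSq p.1 p.2 ^ (-(((n : ℝ) + 2 * s) / 2)))) p := by
  obtain ⟨τ, φ⟩ := p
  simp only at hp
  have h0 : 0 < τ := by linarith
  have hQ := distSq_pos h0.le hp.ne' φ
  have hinv : distSq τ⁻¹ φ ^ (-(((n : ℝ) + 2 * s) / 2)) =
      τ ^ ((n : ℝ) + 2 * s) * distSq τ φ ^ (-(((n : ℝ) + 2 * s) / 2)) := by
    rw [distSq_inv h0, div_rpow hQ.le (by positivity), ← rpow_natCast τ 2, ← rpow_mul h0.le,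
      show ((2 : ℕ) : ℝ) * -(((n : ℝ) + 2 * s) / 2) = -((n : ℝ) + 2 * s) by push_cast; ring,
      rpow_neg h0.le, div_inv_eq_mul, mul_comm]
  have hpow : τ⁻¹ ^ n * τ ^ ((n : ℝ) + 2 * s) = τ ^ n * τ ^ (-(n : ℝ) + 2 * s) := by
    rw [inv_pow, rpow_add h0, rpow_add h0, rpow_neg h0.le, rpow_natCast]
    field_simp
  -- Inversion raises the truncation radius from δ to δτ; the gap between the two conditions
  -- supports the subtracted term.
  have hcond : δ ^ 2 < distSq τ⁻¹ φ ↔ (δ * τ) ^ 2 < distSq τ φ := by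
    rw [distSq_inv h0, lt_div_iff₀ (by positivity), mul_pow]
  have himp : (δ * τ) ^ 2 < distSq τ φ → δ ^ 2 < distSq τ φ := by
    intro h
    refine lt_of_le_of_lt ?_ h
    rw [mul_pow]
    exact le_mul_of_one_le_right (sq_nonneg δ) (one_le_pow₀ hp.le)
  simp only [truncated, indicator_apply, mem_ofPred_eq, hinv, hcond, symDiff, ← div_eq_mul_inv]
  by_cases h1 : (δ * τ) ^ 2 < distSq τ φ
  · have h2 := himp h1
    rw [if_pos h1, if_pos h2, if_pos h2, if_neg (by simpa [h2] using h1)]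
    linear_combination (u r - u (r / τ)) * distSq τ φ ^ (-(((n : ℝ) + 2 * s) / 2)) * hpow
  · rw [if_neg h1]
    by_cases h2 : δ ^ 2 < distSq τ φ
    · rw [if_pos h2, if_pos h2, if_pos ⟨h2, not_lt.1 h1⟩]
      ring
    · rw [if_neg h2, if_neg h2, if_neg (by simp [h2])]
      ring

/-- The expression is δ^(1-2s)((1-δ)^(-n) - 1) = O(δ^(2-2s)). -/
lemma tendsto_shell_bound {n : ℕ} {s : ℝ} (hs1 : s < 1) :
    Tendsto (fun δ : ℝ => δ ^ (1 - (n : ℝ) - 2 * s) * ((δ / (1 - δ)) ^ n - δ ^ n))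
      (𝓝[>] 0) (𝓝 0) := by
  have hd : DifferentiableAt ℝ (fun δ : ℝ => ((1 - δ) ^ n)⁻¹) 0 := by
    refine DifferentiableAt.inv (by fun_prop) (by simp)
  have hO : (fun δ : ℝ => ((1 - δ) ^ n)⁻¹ - 1) =O[𝓝[>] 0] fun δ => δ := by
    have := hd.isBigO_sub.mono (nhdsWithin_le_nhds (s := Ioi (0 : ℝ)))
    simpa using this
  have h1 : (fun δ : ℝ => δ ^ (1 - 2 * s) * (((1 - δ) ^ n)⁻¹ - 1)) =O[𝓝[>] 0]
      fun δ => δ ^ (1 - 2 * s) * δ := (isBigO_refl _ _).mul hO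
  have h2 : Tendsto (fun δ : ℝ => δ ^ (1 - 2 * s) * δ) (𝓝[>] 0) (𝓝 0) := by
    have h3 : Tendsto (fun δ : ℝ => δ ^ (2 - 2 * s)) (𝓝[>] 0) (𝓝 0) := by
      have := (continuousAt_rpow_const (0 : ℝ) (2 - 2 * s) (Or.inr (by linarith))).tendsto
      rw [zero_rpow (by linarith)] at this
      exact this.mono_left nhdsWithin_le_nhds
    refine h3.congr' ?_
    filter_upwards [self_mem_nhdsWithin] with δ hδ
    rw [mem_Ioi] at hδ
    rw [← rpow_add_one hδ.ne']
    congr 1; ring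
  refine (h1.trans_tendsto h2).congr' ?_
  filter_upwards [self_mem_nhdsWithin] with δ hδ
  rw [mem_Ioi] at hδ
  have : δ ^ (1 - 2 * s) = δ ^ (1 - (n : ℝ) - 2 * s) * δ ^ n := by
    rw [← rpow_natCast, ← rpow_add hδ]
    congr 1; ring
  rw [this, div_pow]
  ring

/-- The contribution of the region where the truncation is not symmetric. -/
noncomputable def defect (n : ℕ) (s : ℝ) (u : ℝ → ℝ) (r δ : ℝ) (p : ℝ × ℝ) : ℝ :=
  {p : ℝ × ℝ | δ ^ 2 < distSq p.1 p.2 ∧ distSq p.1 p.2 ≤ (δ * p.1) ^ 2}.indicator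
    (fun p => p.1 ^ n * ((u r - u (r / p.1)) * p.1 ^ (-(n : ℝ) + 2 * s) *
      distSq p.1 p.2 ^ (-(((n : ℝ) + 2 * s) / 2)))) p

/-- On the defect region (τ-1)² ≤ Q ≤ (δτ)², so τ ≤ 1/(1-δ) and τ - 1 ≤ 2δ. This places the region
in a thin shell and makes the difference of u at most 2Cδ. -/
lemma abs_defect_le {n : ℕ} (hn : 2 ≤ n) {s : ℝ} (hs : 0 < s) (hs1 : s < 1) {u : ℝ → ℝ} {r C : ℝ}
    (hC : 0 ≤ C) (hu : ∀ τ ∈ Icc (1 : ℝ) 2, |u r - u (r / τ)| ≤ C * (τ - 1)) {δ : ℝ}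
    (hδ : 0 < δ) (hδ' : δ ≤ 1 / 2) {p : ℝ × ℝ} (hp : 1 < p.1) :
    |defect n s u r δ p| ≤ 2 * C * δ ^ (1 - (n : ℝ) - 2 * s) *
      (p.1 ^ n * (shell δ (δ / (1 - δ))).indicator 1 p) := by
  have hn' : (2 : ℝ) ≤ n := by exact_mod_cast hn
  obtain ⟨τ, φ⟩ := p
  simp only at hp
  have h0 : 0 < τ := by linarith
  unfold defect
  by_cases h : δ ^ 2 < distSq τ φ ∧ distSq τ φ ≤ (δ * τ) ^ 2
  swap
  · rw [indicator_of_notMem (by exact h), abs_zero]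
    have : 0 ≤ (shell δ (δ / (1 - δ))).indicator (1 : ℝ × ℝ → ℝ) (τ, φ) :=
      indicator_nonneg (fun _ _ => zero_le_one) _
    positivity
  obtain ⟨h1, h2⟩ := h
  have h3 : τ - 1 ≤ δ * τ := by
    have := (sub_one_sq_le_distSq h0.le φ).trans h2
    exact (sq_le_sq₀ (by linarith) (by positivity)).1 this
  have hδ1 : 0 < 1 - δ := by linarith
  have h4 : τ ≤ 1 / (1 - δ) := by rw [le_div_iff₀ hδ1]; linarith
  have h5 : τ ≤ 2 := h4.trans (by rw [div_le_iff₀ hδ1]; linarith)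
  have h6 : τ - 1 ≤ 2 * δ := h3.trans (by nlinarith)
  have hQ := distSq_pos h0.le hp.ne' φ
  have hmem : (τ, φ) ∈ shell δ (δ / (1 - δ)) := by
    refine ⟨h1, h2.trans ?_⟩
    rw [div_eq_mul_one_div]
    gcongr
  rw [indicator_of_mem (show (τ, φ) ∈ {p : ℝ × ℝ | δ ^ 2 < distSq p.1 p.2 ∧
    distSq p.1 p.2 ≤ (δ * p.1) ^ 2} from ⟨h1, h2⟩), indicator_of_mem hmem]
  have h7 : τ ^ (-(n : ℝ) + 2 * s) ≤ 1 :=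
    rpow_le_one_of_one_le_of_nonpos hp.le (by linarith)
  have h8 : distSq τ φ ^ (-(((n : ℝ) + 2 * s) / 2)) ≤ δ ^ (-((n : ℝ) + 2 * s)) := by
    have : (δ ^ 2) ^ (-(((n : ℝ) + 2 * s) / 2)) = δ ^ (-((n : ℝ) + 2 * s)) := by
      rw [← rpow_natCast δ 2, ← rpow_mul hδ.le]
      congr 1; push_cast; ring
    rw [← this]
    exact rpow_le_rpow_of_nonpos (by positivity) h1.le (by linarith)
  have h9 : |u r - u (r / τ)| ≤ C * (2 * δ) := (hu τ ⟨hp.le, h5⟩).trans (by gcongr)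
  rw [abs_mul, abs_mul, abs_mul, abs_of_nonneg (pow_nonneg h0.le n),
    abs_of_nonneg (rpow_nonneg h0.le _), abs_of_nonneg (rpow_nonneg hQ.le _)]
  calc τ ^ n * (|u r - u (r / τ)| * τ ^ (-(n : ℝ) + 2 * s) *
        distSq τ φ ^ (-(((n : ℝ) + 2 * s) / 2)))
      ≤ τ ^ n * (C * (2 * δ) * 1 * δ ^ (-((n : ℝ) + 2 * s))) := by gcongr
    _ = _ := by
      rw [show (1 - (n : ℝ) - 2 * s) = 1 + -((n : ℝ) + 2 * s) by ring, rpow_add hδ, rpow_one]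
      simp only [Pi.one_apply]
      ring

lemma tendsto_integral_defect {n : ℕ} (hn : 2 ≤ n) {s : ℝ} (hs : 0 < s) (hs1 : s < 1) {u : ℝ → ℝ}
    (hu : ContDiffOn ℝ 2 u (Ioi 0)) {r : ℝ} (hr : 0 < r) :
    Tendsto (fun δ => ∫ p in {p | 1 < p.1}, defect n s u r δ p
      ∂(logMeasure.prod (angleMeasure n))) (𝓝[>] 0) (𝓝 0) := by
  obtain ⟨C, hC, hb⟩ := abs_sub_div_le hu hr
  have hS : MeasurableSet {p : ℝ × ℝ | 1 < p.1} := measurableSet_lt (by fun_prop) (by fun_prop)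
  -- Any nonzero vector serves: it only gives access to the shell volume.
  obtain ⟨x, hx⟩ : ∃ x : EuclideanSpace ℝ (Fin n), x ≠ 0 :=
    ⟨EuclideanSpace.single ⟨0, by omega⟩ 1, by simp⟩
  set V := volume.real (Metric.ball (0 : EuclideanSpace ℝ (Fin n)) 1)
  have hlim := (tendsto_shell_bound (n := n) hs1).const_mul (2 * C * V)
  rw [mul_zero] at hlim
  refine squeeze_zero_norm' ?_ hlim
  filter_upwards [self_mem_nhdsWithin, mem_nhdsWithin_of_mem_nhds
    (Iio_mem_nhds (show (0 : ℝ) < 1 / 2 by norm_num))] with δ hδ hδ'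
  rw [mem_Ioi] at hδ
  rw [mem_Iio] at hδ'
  have hδ1 : 0 < 1 - δ := by linarith
  obtain ⟨i1, i2⟩ := integral_shell hn hx hδ.le
    (show δ ≤ δ / (1 - δ) by rw [le_div_iff₀ hδ1]; nlinarith)
  set M := logMeasure.prod (angleMeasure n)
  set K := 2 * C * δ ^ (1 - (n : ℝ) - 2 * s)
  have hK : 0 ≤ K := by positivity
  calc ‖∫ p in {p | 1 < p.1}, defect n s u r δ p ∂M‖
      ≤ ∫ p in {p | 1 < p.1}, K * (p.1 ^ n * (shell δ (δ / (1 - δ))).indicator 1 p) ∂M := by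
        refine norm_integral_le_of_norm_le (i1.const_mul K).integrableOn ?_
        filter_upwards [ae_restrict_mem hS] with p hp
        exact abs_defect_le hn hs hs1 hC hb hδ hδ'.le hp
    _ ≤ ∫ p, K * (p.1 ^ n * (shell δ (δ / (1 - δ))).indicator 1 p) ∂M := by
        refine setIntegral_le_integral (i1.const_mul K) ?_
        filter_upwards [prod_ae_pos n] with p hp
        have : 0 ≤ (shell δ (δ / (1 - δ))).indicator (1 : ℝ × ℝ → ℝ) p :=
          indicator_nonneg (fun _ _ => zero_le_one) _
        simp only [Pi.zero_apply]
        positivity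
    _ = _ := by
        rw [integral_const_mul, i2]
        simp only [K, V]
        ring

lemma tendsto_integral_symmetric {F : ℝ × ℝ → ℝ} {M : Measure (ℝ × ℝ)}
    (hF : IntegrableOn F {p | 1 < p.1} M) :
    Tendsto (fun δ : ℝ => ∫ p in {p | 1 < p.1},
      {p : ℝ × ℝ | δ ^ 2 < distSq p.1 p.2}.indicator F p ∂M) (𝓝[>] 0)
      (𝓝 (∫ p in {p | 1 < p.1}, F p ∂M)) := by
  have hS : MeasurableSet {p : ℝ × ℝ | 1 < p.1} := measurableSet_lt (by fun_prop) (by fun_prop)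
  refine tendsto_integral_filter_of_dominated_convergence (fun p => ‖F p‖) ?_ ?_ hF.norm ?_
  · exact Eventually.of_forall fun δ => hF.aestronglyMeasurable.indicator
      (measurableSet_lt measurable_const continuous_distSq.measurable)
  · exact Eventually.of_forall fun δ => Eventually.of_forall fun p => norm_indicator_le_norm_self _ _
  · filter_upwards [ae_restrict_mem hS] with p hp
    have hp' : 1 < p.1 := hp
    have hQ := distSq_pos (by linarith) hp'.ne' p.2
    refine tendsto_const_nhds.congr' ?_
    have hsq : Tendsto (fun δ : ℝ => δ ^ 2) (𝓝[>] 0) (𝓝 0) := by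
      have : Continuous fun δ : ℝ => δ ^ 2 := by fun_prop
      have h := this.tendsto 0
      simp only [ne_eq, OfNat.ofNat_ne_zero, not_false_eq_true, zero_pow] at h
      exact h.mono_left nhdsWithin_le_nhds
    filter_upwards [hsq.eventually_lt_const hQ] with δ hδ
    rw [indicator_of_mem (show p ∈ {p : ℝ × ℝ | δ ^ 2 < distSq p.1 p.2} from hδ)]

lemma tendsto_truncated_integral {n : ℕ} (hn : 2 ≤ n) {s : ℝ} (hs : 0 < s) (hs1 : s < 1)
    {u : ℝ → ℝ} (hum : Measurable u) (hu : ContDiffOn ℝ 2 u (Ioi 0))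
    (hI : IntegrableOn (weighted n s u) (Ioi 0)) {x : EuclideanSpace ℝ (Fin n)} (hx : x ≠ 0) :
    Tendsto (fun ε : ℝ => ∫ y in {y | ε < ‖x - y‖}, fracIntegrand s (fun y => u ‖y‖) x y)
      (𝓝[>] 0) (𝓝 (‖x‖ ^ (-2 * s) * ∫ τ in Ioi 1, symDiff n s u ‖x‖ τ * kern n s τ)) := by
  have hr : 0 < ‖x‖ := norm_pos_iff.2 hx
  set r := ‖x‖
  set M := logMeasure.prod (angleMeasure n)
  have hS : MeasurableSet {p : ℝ × ℝ | 1 < p.1} := measurableSet_lt (by fun_prop) (by fun_prop)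
  set F : ℝ × ℝ → ℝ := fun p => p.1 ^ n *
    (symDiff n s u r p.1 * distSq p.1 p.2 ^ (-(((n : ℝ) + 2 * s) / 2)))
  have hsm : Measurable (symDiff n s u r) := by unfold symDiff; fun_prop
  obtain ⟨hF, hF'⟩ := integrable_mul_distSq hn hs hsm
    (integrableOn_symDiff_mul_kern hn hs hs1 hu hI hr)
  have hlim := (tendsto_integral_symmetric hF).sub
    (tendsto_integral_defect hn hs hs1 hu hr)
  rw [sub_zero, hF'] at hlim
  have key : ∀ δ : ℝ, 0 < δ →
      ∫ y in {y | δ * r < ‖x - y‖}, fracIntegrand s (fun y => u ‖y‖) x y =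
      r ^ (-2 * s) * ((∫ p in {p | 1 < p.1},
        {p : ℝ × ℝ | δ ^ 2 < distSq p.1 p.2}.indicator F p ∂M) -
        ∫ p in {p | 1 < p.1}, defect n s u r δ p ∂M) := by
    intro δ hδ
    have hD : MeasurableSet {y : EuclideanSpace ℝ (Fin n) | δ * r < ‖x - y‖} :=
      measurableSet_lt (by fun_prop) (by fun_prop)
    have hTm := measurable_truncated n s hum r δ
    have hint := (integrable_indicator_iff hD).2
      (integrableOn_fracIntegrand hn hs hum hI x (mul_pos hδ hr))
    have hfun := funext (indicator_fracIntegrand_eq s u hx hδ.le)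
    rw [hfun, integrable_const_mul_iff (IsUnit.mk0 _ (rpow_pos_of_pos hr _).ne'),
      integrable_polar hn hx hTm] at hint
    rw [← integral_indicator hD, hfun, integral_const_mul, integral_polar hn hx hTm,
      integral_eq_integral_add_inv n hint, ← mul_assoc]
    have e1 : r ^ (-((n : ℝ) + 2 * s)) * r ^ n = r ^ (-2 * s) := by
      rw [← rpow_natCast, ← rpow_add hr]
      congr 1; ring
    have hintJ : Integrable (fun p : ℝ × ℝ => p.1⁻¹ ^ n * truncated n s u r δ (p.1⁻¹, p.2)) M :=
      ((measurePreserving_inv_prod n).integrable_comp_emb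
      measurableEmbedding_inv_prod).2 hint
    rw [e1, ← integral_add hint.integrableOn hintJ.integrableOn]
    congr 1
    have hF1 : IntegrableOn ({p : ℝ × ℝ | δ ^ 2 < distSq p.1 p.2}.indicator F) {p | 1 < p.1} M :=
      Integrable.indicator hF (measurableSet_lt measurable_const continuous_distSq.measurable)
    have heq : ∀ p ∈ {p : ℝ × ℝ | 1 < p.1}, p.1 ^ n * truncated n s u r δ p +
        p.1⁻¹ ^ n * truncated n s u r δ (p.1⁻¹, p.2) =
        {p : ℝ × ℝ | δ ^ 2 < distSq p.1 p.2}.indicator F p - defect n s u r δ p :=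
      fun p hp => truncated_add_inv n s u r hp
    -- Integrability of the defect is read off from the folding identity, its other terms being
    -- integrable.
    have hF2 : IntegrableOn (defect n s u r δ) {p | 1 < p.1} M := by
      refine (hF1.sub (hint.add hintJ).integrableOn).congr_fun (fun p hp => ?_) hS
      have := heq p hp
      simp only [Pi.sub_apply, Pi.add_apply]
      linarith
    rw [← integral_sub hF1 hF2]
    exact setIntegral_congr_fun hS heq
  have hlim2 := hlim.const_mul (r ^ (-2 * s))
  have hscale : Tendsto (fun ε : ℝ => ε / r) (𝓝[>] 0) (𝓝[>] 0) := by
    refine tendsto_nhdsWithin_iff.2 ⟨?_, ?_⟩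
    · have : Continuous fun ε : ℝ => ε / r := by fun_prop
      have h := this.tendsto 0
      rw [zero_div] at h
      exact h.mono_left nhdsWithin_le_nhds
    · filter_upwards [self_mem_nhdsWithin] with ε hε
      exact div_pos hε hr
  refine (hlim2.comp hscale).congr' ?_
  filter_upwards [self_mem_nhdsWithin] with ε hε
  rw [Function.comp, ← key (ε / r) (div_pos hε hr), div_mul_cancel₀ _ hr.ne']

/-! ### Assembling the representation formula -/

lemma hasFracLaplacianAt_of_measurable {n : ℕ} (hn : 2 ≤ n) {s : ℝ} (hs : 0 < s) (hs1 : s < 1)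
    (c : ℝ) {u : ℝ → ℝ} (hum : Measurable u) (hu : ContDiffOn ℝ 2 u (Ioi 0))
    (hI : IntegrableOn (weighted n s u) (Ioi 0)) {x : EuclideanSpace ℝ (Fin n)} (hx : x ≠ 0) :
    HasFracLaplacianAt c s (fun y => u ‖y‖) x
      (c * ‖x‖ ^ (-2 * s) * ∫ τ in Ioi 1, symDiff n s u ‖x‖ τ * kern n s τ) := by
  have hr : 0 < ‖x‖ := norm_pos_iff.2 hx
  have hlim := tendsto_truncated_integral hn hs hs1 hum hu hI hx
  rw [mul_assoc]
  refine ⟨fun ε hε => integrableOn_fracIntegrand hn hs hum hI x hε, hlim.const_mul c, fun hs2 => ?_⟩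
  have hd : DifferentiableAt ℝ u ‖x‖ :=
    (hu.contDiffAt (Ioi_mem_nhds hr)).differentiableAt (by norm_num)
  have hint := integrable_fracIntegrand hn hs hs2 hum hI hd
  refine ⟨hint, ?_⟩
  congr 1
  -- For s < 1/2 the truncated integrals also converge, by domination, to the full Lebesgue
  -- integral.
  refine tendsto_nhds_unique ?_ hlim
  have hD : ∀ ε : ℝ, MeasurableSet {y : EuclideanSpace ℝ (Fin n) | ε < ‖x - y‖} :=
    fun ε => measurableSet_lt (by fun_prop) (by fun_prop)
  simp_rw [← integral_indicator (hD _)]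
  refine tendsto_integral_filter_of_dominated_convergence
    (fun y => ‖fracIntegrand s (fun y => u ‖y‖) x y‖) ?_ ?_ hint.norm ?_
  · exact Eventually.of_forall fun ε => hint.aestronglyMeasurable.indicator (hD ε)
  · exact Eventually.of_forall fun ε => Eventually.of_forall fun y =>
      norm_indicator_le_norm_self _ _
  · refine Eventually.of_forall fun y => ?_
    by_cases hxy : x = y
    · have h0 : fracIntegrand s (fun y => u ‖y‖) x y = 0 := by simp [fracIntegrand, hxy]
      refine tendsto_const_nhds.congr fun ε => ?_
      rw [h0, indicator_apply, h0, ite_self]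
    · refine tendsto_const_nhds.congr' ?_
      have hpos : 0 < ‖x - y‖ := norm_pos_iff.2 (sub_ne_zero.2 hxy)
      filter_upwards [mem_nhdsWithin_of_mem_nhds (Iio_mem_nhds hpos)] with ε hε
      rw [indicator_of_mem (show y ∈ {y | ε < ‖x - y‖} from hε)]

lemma HasFracLaplacianAt.congr_ae {n : ℕ} {c s : ℝ} {U V : EuclideanSpace ℝ (Fin n) → ℝ}
    {x : EuclideanSpace ℝ (Fin n)} {L : ℝ} (h : HasFracLaplacianAt c s U x L) (hUV : U =ᵐ[volume] V)
    (hx : U x = V x) : HasFracLaplacianAt c s V x L := by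
  have he : fracIntegrand s U x =ᵐ[volume] fracIntegrand s V x := by
    filter_upwards [hUV] with y hy
    simp only [fracIntegrand, hx, hy]
  obtain ⟨h1, h2, h3⟩ := h
  refine ⟨fun ε hε => (h1 ε hε).congr (ae_restrict_of_ae he), h2.congr fun ε => ?_, fun hs => ?_⟩
  · rw [integral_congr_ae (ae_restrict_of_ae he)]
  · obtain ⟨h4, h5⟩ := h3 hs
    exact ⟨h4.congr he, by rw [← integral_congr_ae he, h5]⟩

lemma radial_representation {n : ℕ} (hn : 2 ≤ n) {s : ℝ} (hs : 0 < s) (hs1 : s < 1)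
    (c : ℝ) {u : ℝ → ℝ} (hu : ContDiffOn ℝ 2 u (Ioi 0))
    (hI : IntegrableOn (weighted n s u) (Ioi 0)) {x : EuclideanSpace ℝ (Fin n)} (hx : x ≠ 0) :
    IntegrableOn (radialIntegrand n s u ‖x‖) (Ioi 1) ∧
    HasFracLaplacianAt c s (fun y => u ‖y‖) x
      (c * ‖x‖ ^ (-2 * s) * ∫ τ in Ioi (1 : ℝ), radialIntegrand n s u ‖x‖ τ) := by
  have hr : 0 < ‖x‖ := norm_pos_iff.2 hx
  refine ⟨integrableOn_symDiff_mul_kern hn hs hs1 hu hI hr, ?_⟩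
  -- The profile is arbitrary on (-∞, 0] and may fail to be measurable. Setting it to zero there
  -- restores measurability and changes the radial function at most at the origin.
  set v : ℝ → ℝ := (Ioi (0 : ℝ)).indicator u
  have hvu : ∀ ρ, 0 < ρ → v ρ = u ρ := fun ρ hρ => indicator_of_mem (mem_Ioi.2 hρ) u
  have hvm : Measurable v := by
    have := hu.continuousOn.measurable_piecewise (g := (0 : ℝ → ℝ)) continuousOn_const
      measurableSet_Ioi
    rwa [piecewise_eq_indicator] at this
  have hv : ContDiffOn ℝ 2 v (Ioi 0) := hu.congr fun ρ hρ => hvu ρ hρ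
  have hvI : IntegrableOn (weighted n s v) (Ioi 0) :=
    hI.congr_fun (fun ρ hρ => by simp only [weighted, hvu ρ hρ]) measurableSet_Ioi
  have h := hasFracLaplacianAt_of_measurable hn hs hs1 c hvm hv hvI hx
  have hint : ∫ τ in Ioi 1, symDiff n s v ‖x‖ τ * kern n s τ =
      ∫ τ in Ioi (1 : ℝ), radialIntegrand n s u ‖x‖ τ := by
    refine setIntegral_congr_fun measurableSet_Ioi fun τ hτ => ?_
    have hτ0 : 0 < τ := zero_lt_one.trans hτ
    simp only [symDiff, hvu _ hr, hvu _ (mul_pos hr hτ0), hvu _ (div_pos hr hτ0)]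
    rfl
  rw [hint] at h
  have : Nontrivial (EuclideanSpace ℝ (Fin n)) := ⟨x, 0, hx⟩
  refine h.congr_ae ?_ (hvu _ hr)
  have hne : ∀ᵐ y : EuclideanSpace ℝ (Fin n), y ≠ 0 := by simp [ae_iff]
  filter_upwards [hne] with y hy
  exact hvu _ (norm_pos_iff.2 hy)

end RadialFracLap

theorem theorem1p1 (n : ℕ) (hn : 2 ≤ n) (s : ℝ) (hs0 : 0 < s) (hs1 : s < 1) :
    -- the representation formula, for every radial function with profile `u`
    (∀ c : ℝ, 0 < c → ∀ u : ℝ → ℝ, ContDiffOn ℝ 2 u (Ioi 0) →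
      IntegrableOn (fun r : ℝ => |u r| / (1 + r) ^ ((n : ℝ) + 2 * s) * r ^ (n - 1)) (Ioi 0) →
      ∀ x : EuclideanSpace ℝ (Fin n), x ≠ 0 →
        IntegrableOn (RadialFracLap.radialIntegrand n s u ‖x‖) (Ioi 1) ∧
        RadialFracLap.HasFracLaplacianAt c s (fun y => u ‖y‖) x
          (c * ‖x‖ ^ (-2 * s) * ∫ τ in Ioi (1 : ℝ), RadialFracLap.radialIntegrand n s u ‖x‖ τ)) ∧
    -- the properties of the kernel
    (∀ τ : ℝ, 1 ≤ τ → 0 < RadialFracLap.H n s τ) ∧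
    ContinuousOn (RadialFracLap.H n s) (Ici 1) ∧
    (RadialFracLap.H n s =Θ[atTop] fun τ : ℝ => τ ^ (2 * s)) ∧
    (∀ τ : ℝ, 1 < τ →
      τ * (τ ^ 2 - 1) ^ (-1 - 2 * s) * RadialFracLap.H n s τ =
        2 * Real.pi ^ ((n : ℝ) / 2) / Real.Gamma ((n : ℝ) / 2) * τ ^ (-1 - 2 * s) *
          ordinaryHypergeometric (((n : ℝ) + 2 * s) / 2) (1 + s) ((n : ℝ) / 2)
            (τ ^ (-2 : ℝ))) ∧
    (∃ C₁ C₂ : ℝ, 0 < C₁ ∧ 0 < C₂ ∧ ∀ τ : ℝ, 1 < τ →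
      C₁ * (τ - 1) ^ (-1 - 2 * s) ≤ τ * (τ ^ 2 - 1) ^ (-1 - 2 * s) * RadialFracLap.H n s τ ∧
      τ * (τ ^ 2 - 1) ^ (-1 - 2 * s) * RadialFracLap.H n s τ ≤ C₂ * (τ - 1) ^ (-1 - 2 * s)) := by
  refine ⟨fun c _ u hu hI x hx => ?_, fun τ hτ => RadialFracLap.H_pos hn hs0 hτ,
    RadialFracLap.continuousOn_H n hs0, RadialFracLap.H_isTheta hn hs0,
    fun τ hτ => RadialFracLap.kernel_eq_hypergeometric hn s hτ, RadialFracLap.kernel_bounds hn hs0⟩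
  exact RadialFracLap.radial_representation hn hs0 hs1 c hu hI hx
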